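/- Let $\Omega\subset\mathbb R^2$ be a bounded domain with smooth boundary and let $\nu$ be its unit outward normal. Let $D$ be an open set with $\overline D\subset\Omega$ and Lipschitz boundary, having finitely many connected components $D_1,\dots,D_m$ whose closures are pairwise disjoint. Let $\gamma$ be equal to a positive constant $k_j$ on each $D_j$ and to $1$ on $\Omega\setminus D$. Let $P\neq Q$ be two points of $\partial\Omega$, and set $$V(x)=-\frac1\pi\bigl(\log|P-x|-\log|Q-x|\bigr),\qquad \Psi(y)=-\frac1\pi\left(\frac{y-P}{|y-P|^2}-\frac{y-Q}{|y-Q|^2}\right)\cdot\nu(y),\quad y\in\partial\Omega\setminus\{P,Q\}.$$ Let $\mathcal E\in H^1(\Omega)$ be the weak solution of $$\nabla\cdot\gamma\nabla\mathcal E=-\nabla\cdot(\gamma-1)\nabla V\ \text{ in }\Omega,\qquad \frac{\partial\mathcal E}{\partial\nu}=-\Psi\ \text{ on }\partial\Omega,\qquad \int_{\partial\Omega}\mathcal E\,d\sigma=0,$$ that is, $\int_{\partial\Omega}\mathcal E\,d\sigma=0$ in the sense of traces and, for all $\psi\in H^1(\Omega)$, $$\int_\Omega\gamma\nabla\mathcal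 E\cdot\nabla\psi\,dx=-\int_\Omega(\gamma-1)\nabla V\cdot\nabla\psi\,dx-\int_{\partial\Omega}\Psi\,\psi\,d\sigma .$$ Put $\mathcal D=V+\mathcal E$ in $\Omega$. Then $\mathcal D$ has a locally integrable weak gradient in $\Omega$, and for every real-valued $\varphi\in H^1(\Omega)$ that is smooth (up to the boundary) in a neighbourhood of $\partial\Omega$ the function $\gamma\nabla\mathcal D\cdot\nabla\varphi$ is integrable on $\Omega$ and $$\int_\Omega\gamma\,\nabla\mathcal D\cdot\nabla\varphi\,dx=\varphi(P)-\varphi(Q).$$ In this sense $\mathcal D$ solves $\nabla\cdot\gamma\nabla\mathcal D=0$ in $\Omega$, $\partial\mathcal D/\partial\nu=\delta_P-\delta_Q$ on $\partial\Omega$. -/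

import Mathlib

open MeasureTheory Set Filter Topology
open scoped ContDiff RealInnerProductSpace

noncomputable section

namespace PointCurrent

/-- The Euclidean plane. -/
abbrev Plane : Type := EuclideanSpace ℝ (Fin 2)

/-! ### Domains, boundaries, normals -/

/-- Near `p`, and in the coordinates given by the linear isometry `L`, the set `S` is the region
strictly below the graph of `f`. -/
def IsHypographNear (S : Set Plane) (p : Plane) (L : Plane ≃ₗᵢ[ℝ] Plane) (f : ℝ → ℝ) : Prop :=
  ∃ r : ℝ, 0 < r ∧ ∀ x ∈ Metric.ball p r, (x ∈ S ↔ (L x) 1 < f ((L x) 0))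

/-- The boundary of `S` is locally a smooth graph, with `S` on one side of it. -/
def HasSmoothBoundary (S : Set Plane) : Prop :=
  ∀ p ∈ frontier S, ∃ (L : Plane ≃ₗᵢ[ℝ] Plane) (f : ℝ → ℝ),
    ContDiff ℝ ∞ f ∧ IsHypographNear S p L f

/-- The boundary of `S` is locally a Lipschitz graph, with `S` on one side of it. -/
def HasLipschitzBoundary (S : Set Plane) : Prop :=
  ∀ p ∈ frontier S, ∃ (L : Plane ≃ₗᵢ[ℝ] Plane) (f : ℝ → ℝ),
    (∃ K : NNReal, LipschitzWith K f) ∧ IsHypographNear S p L f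

/-- A bounded domain (nonempty connected open set) of the plane with smooth boundary. -/
structure IsSmoothBoundedDomain (Ω : Set Plane) : Prop where
  isOpen : IsOpen Ω
  isConnected : IsConnected Ω
  isBounded : Bornology.IsBounded Ω
  smooth : HasSmoothBoundary Ω

/-- `n` is the unit outward normal of `Ω` at the boundary point `p`: directions that make an obtuse
angle with `n` enter `Ω`, and directions that make an acute angle with `n` leave `closure Ω`. -/
def IsOutwardUnitNormal (Ω : Set Plane) (p n : Plane) : Prop :=
  ‖n‖ = 1 ∧
  (∀ v : Plane, ⟪v, n⟫ < 0 → ∀ᶠ t in 𝓝[>] (0 : ℝ), p + t • v ∈ Ω) ∧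
  (∀ v : Plane, 0 < ⟪v, n⟫ → ∀ᶠ t in 𝓝[>] (0 : ℝ), p + t • v ∉ closure Ω)

/-- The unit outward normal field `ν` on the boundary of `Ω`. -/
def outwardNormal (Ω : Set Plane) (p : Plane) : Plane :=
  Classical.epsilon (IsOutwardUnitNormal Ω p)

/-- Arc length on the boundary of `Ω`. -/
def boundaryMeasure (Ω : Set Plane) : Measure Plane :=
  (Measure.hausdorffMeasure 1).restrict (frontier Ω)

/-! ### Sobolev functions and traces -/

/-- `G` is the weak gradient of `u` on `Ω`. -/
structure HasWeakGradient (Ω : Set Plane) (u : Plane → ℝ) (G : Plane → Plane) : Prop where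
  locallyIntegrableOn : LocallyIntegrableOn u Ω
  locallyIntegrableOn_gradient : LocallyIntegrableOn G Ω
  integral_eq : ∀ ψ : Plane → ℝ, ContDiff ℝ ∞ ψ → HasCompactSupport ψ → tsupport ψ ⊆ Ω →
    ∫ x in Ω, u x • gradient ψ x = - ∫ x in Ω, ψ x • G x

/-- `u ∈ H¹(Ω)`, with weak gradient `G`. -/
structure HasH1Gradient (Ω : Set Plane) (u : Plane → ℝ) (G : Plane → Plane) : Prop where
  memLp : MemLp u 2 (volume.restrict Ω)
  memLp_gradient : MemLp G 2 (volume.restrict Ω)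
  weak : HasWeakGradient Ω u G

/-- `u ∈ H¹(Ω)`. -/
def MemH1 (Ω : Set Plane) (u : Plane → ℝ) : Prop :=
  ∃ G : Plane → Plane, HasH1Gradient Ω u G

/-- `T ∈ L²(∂Ω)` is the trace of `u ∈ H¹(Ω)`: the graph of the trace operator is the closure in
`H¹(Ω) × L²(∂Ω)` of the graph of the restriction to `∂Ω` of functions in `H¹(Ω) ∩ C(closure Ω)`. -/
def HasTrace (Ω : Set Plane) (u T : Plane → ℝ) : Prop :=
  MemLp T 2 (boundaryMeasure Ω) ∧
  ∃ (G : Plane → Plane) (w : ℕ → Plane → ℝ) (H : ℕ → Plane → Plane),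
    HasH1Gradient Ω u G ∧
    (∀ n, HasH1Gradient Ω (w n) (H n)) ∧
    (∀ n, ContinuousOn (w n) (closure Ω)) ∧
    Tendsto (fun n => eLpNorm (w n - u) 2 (volume.restrict Ω)) atTop (𝓝 0) ∧
    Tendsto (fun n => eLpNorm (H n - G) 2 (volume.restrict Ω)) atTop (𝓝 0) ∧
    Tendsto (fun n => eLpNorm (w n - T) 2 (boundaryMeasure Ω)) atTop (𝓝 0)

/-! ### Inclusions and conductivities -/

/-- `D 0, …, D (m - 1)` are the connected components of an open set whose closure lies in `Ω`, whose
boundary is Lipschitz, and whose components have pairwise disjoint closures. -/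
structure IsInclusion (Ω : Set Plane) {m : ℕ} (D : Fin m → Set Plane) : Prop where
  isOpen : ∀ j, IsOpen (D j)
  isConnected : ∀ j, IsConnected (D j)
  closure_subset : closure (⋃ j, D j) ⊆ Ω
  disjoint_closure : ∀ i j, i ≠ j → Disjoint (closure (D i)) (closure (D j))
  lipschitz : HasLipschitzBoundary (⋃ j, D j)

/-- `γ` is a positive constant on each component of the inclusion and `1` on the rest of `Ω`. -/
structure IsConductivity (Ω : Set Plane) {m : ℕ} (D : Fin m → Set Plane) (γ : Plane → ℝ) :
    Prop where
  const_on_component : ∀ j, ∃ k : ℝ, 0 < k ∧ ∀ x ∈ D j, γ x = k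
  eq_one : ∀ x ∈ Ω \ ⋃ j, D j, γ x = 1

/-! ### The singular part and the corrector -/

/-- The potential `V(P,Q;x) = -(1/π) (log |P - x| - log |Q - x|)`. -/
def V (P Q x : Plane) : ℝ :=
  -(1 / Real.pi) * (Real.log ‖P - x‖ - Real.log ‖Q - x‖)

/-- The boundary flux
`Ψ(P,Q;y) = -(1/π) ((y - P) / |y - P|² - (y - Q) / |y - Q|²) · ν(y)` on `∂Ω \ {P, Q}`. -/
def Psi (Ω : Set Plane) (P Q y : Plane) : ℝ :=
  -(1 / Real.pi) *
    ⟪(1 / ‖y - P‖ ^ 2) • (y - P) - (1 / ‖y - Q‖ ^ 2) • (y - Q), outwardNormal Ω y⟫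

/-- `e` is the `H¹(Ω)` solution of the Neumann problem
`∇·γ∇e = -∇·(γ - 1)∇V` in `Ω`, `∂e/∂ν = -Ψ` on `∂Ω`, `∫_{∂Ω} e = 0`,
in the usual weak sense, tested against all of `H¹(Ω)` (recall `γ = 1` near `∂Ω`). -/
structure IsCorrector (Ω : Set Plane) (γ : Plane → ℝ) (P Q : Plane) (e : Plane → ℝ) : Prop where
  memH1 : MemH1 Ω e
  weak_eq : ∀ (G : Plane → Plane) (φ : Plane → ℝ) (H : Plane → Plane) (T : Plane → ℝ),
    HasH1Gradient Ω e G → HasH1Gradient Ω φ H → HasTrace Ω φ T →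
    ∫ x in Ω, γ x * ⟪G x, H x⟫ =
      - (∫ x in Ω, (γ x - 1) * ⟪gradient (V P Q) x, H x⟫)
      - ∫ y, Psi Ω P Q y * T y ∂(boundaryMeasure Ω)
  mean_zero : ∃ T : Plane → ℝ, HasTrace Ω e T ∧ ∫ y, T y ∂(boundaryMeasure Ω) = 0

/-- `φ` is smooth, up to the boundary, in a neighbourhood of `∂Ω`. -/
def IsSmoothNearBoundary (Ω : Set Plane) (φ : Plane → ℝ) : Prop :=
  ∃ U : Set Plane, IsOpen U ∧ frontier Ω ⊆ U ∧ ContDiffOn ℝ ∞ φ (U ∩ closure Ω)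

end PointCurrent

end

/-!
Write `K_P x = (x - P) / |x - P|²`, so that `∇V = -(1/π) (K_P - K_Q)`. The field `K_P` is
regularised to `(x - P) / (|x - P|² + ε²)`, whose divergence `2ε² / (|x - P|² + ε²)²` has total mass
`2π` and concentrates at `P` as `ε → 0`. Since `P` lies on the boundary and a blow-up of `Ω` at `P`
is a half-plane, only half of this mass is inside `Ω`, and Green's formula gives in the limit
`∫_Ω K_P · ∇φ = ∫_∂Ω φ K_P · ν - π φ(P)`; the boundary integral converges because `K_P · ν` is
bounded on a smooth curve through `P`. Hence `∫_Ω ∇V · ∇φ = ∫_∂Ω Ψ φ + φ(P) - φ(Q)`, and adding the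
weak equation of the corrector, tested with `φ`, cancels the boundary term.
-/

noncomputable section

namespace PointCurrent

/-! ### Gradients -/

section Gradient

variable {E : Type*} [NormedAddCommGroup E] [InnerProductSpace ℝ E] [CompleteSpace E]
  {f g : E → ℝ} {x : E}

theorem contDiffOn_gradient {s : Set E} (hs : IsOpen s) {m n : WithTop ℕ∞}
    (hf : ContDiffOn ℝ n f s) (hmn : m + 1 ≤ n) : ContDiffOn ℝ m (gradient f) s :=
  (InnerProductSpace.toDual ℝ E).symm.contDiff.comp_contDiffOn (hf.fderiv_of_isOpen hs hmn)

theorem contDiff_gradient {m n : WithTop ℕ∞} (hf : ContDiff ℝ n f) (hmn : m + 1 ≤ n) :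
    ContDiff ℝ m (gradient f) :=
  (InnerProductSpace.toDual ℝ E).symm.contDiff.comp (hf.fderiv_right hmn)

theorem continuous_gradient (hf : ContDiff ℝ 1 f) : Continuous (gradient f) :=
  (contDiff_gradient (m := 0) hf (by simp)).continuous

theorem continuousOn_gradient {s : Set E} (hs : IsOpen s) (hf : ContDiffOn ℝ 1 f s) :
    ContinuousOn (gradient f) s :=
  (contDiffOn_gradient (m := 0) hs hf (by simp)).continuousOn

theorem tsupport_gradient_subset (f : E → ℝ) : tsupport (gradient f) ⊆ tsupport f := by
  refine closure_minimal (fun x hx => support_fderiv_subset ℝ fun h => hx ?_) (isClosed_tsupport f)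
  simp only [gradient, h, map_zero]

theorem hasCompactSupport_gradient (hf : HasCompactSupport f) : HasCompactSupport (gradient f) :=
  hf.mono' ((subset_tsupport _).trans (tsupport_gradient_subset f))

theorem gradient_mul (hf : DifferentiableAt ℝ f x) (hg : DifferentiableAt ℝ g x) :
    gradient (fun y => f y * g y) x = f x • gradient g x + g x • gradient f x := by
  simp only [gradient, fderiv_fun_mul hf hg, map_add, map_smul]

theorem gradient_comp_const_sub {y : E} (hf : DifferentiableAt ℝ f (x - y)) :
    gradient (fun z => f (x - z)) y = - gradient f (x - y) := by
  have h : HasFDerivAt (fun z => f (x - z)) ((fderiv ℝ f (x - y)).comp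
    (-(ContinuousLinearMap.id ℝ E))) y := hf.hasFDerivAt.comp y ((hasFDerivAt_id y).const_sub x)
  simp only [gradient, h.fderiv, ContinuousLinearMap.comp_neg,
    ContinuousLinearMap.comp_id, map_neg]

end Gradient

/-! ### Localisation -/

section Cutoff

variable {E : Type*} [NormedAddCommGroup E] [NormedSpace ℝ E]

theorem exists_cutoff [FiniteDimensional ℝ E] {K W : Set E} (hK : IsCompact K) (hW : IsOpen W)
    (hKW : K ⊆ W) :
    ∃ χ : E → ℝ, ContDiff ℝ ∞ χ ∧ HasCompactSupport χ ∧ tsupport χ ⊆ W ∧ ∀ᶠ x in 𝓝ˢ K, χ x = 1 := by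
  obtain ⟨K', hK', hKK', hK'W⟩ := exists_compact_between hK hW hKW
  obtain ⟨χ, hχ_one, hχ_zero, -⟩ := exists_contMDiffMap_one_nhds_of_subset_interior
    (modelWithCornersSelf ℝ E) (n := (⊤ : ℕ∞)) hK.isClosed hKK'
  have hsupp : tsupport χ ⊆ K' :=
    closure_minimal (fun x hx => by_contra fun h => hx (hχ_zero x h)) hK'.isClosed
  exact ⟨χ, χ.contMDiff.contDiff, HasCompactSupport.of_support_subset_isCompact hK'
    ((subset_tsupport _).trans hsupp), hsupp.trans hK'W, hχ_one⟩

theorem contDiff_mul_of_tsupport_subset {χ u : E → ℝ} {W : Set E} {n : WithTop ℕ∞}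
    (hW : IsOpen W) (hχ : ContDiff ℝ n χ) (hs : tsupport χ ⊆ W) (hu : ContDiffOn ℝ n u W) :
    ContDiff ℝ n fun x => χ x * u x := by
  refine contDiff_iff_contDiffAt.2 fun x => ?_
  by_cases hx : x ∈ W
  · exact hχ.contDiffAt.mul (hu.contDiffAt (hW.mem_nhds hx))
  · refine contDiffAt_const (c := (0 : ℝ)) |>.congr_of_eventuallyEq ?_
    filter_upwards [notMem_tsupport_iff_eventuallyEq.1 fun h => hx (hs h)] with y hy
    rw [hy, Pi.zero_apply, zero_mul]

end Cutoff

theorem setIntegral_eq_integral_of_tsupport_subset {X F F' : Type*} [TopologicalSpace X]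
    [MeasurableSpace X] {μ : Measure X} [NormedAddCommGroup F] [NormedSpace ℝ F] [Zero F']
    {s : Set X} {v : X → F'} (hs : tsupport v ⊆ s) {g : X → F} (hg : ∀ x, v x = 0 → g x = 0) :
    ∫ x in s, g x ∂μ = ∫ x, g x ∂μ :=
  setIntegral_eq_integral_of_forall_compl_eq_zero fun x hx =>
    hg x (image_eq_zero_of_notMem_tsupport fun h => hx (hs h))

section LocallyIntegrable

variable {X F : Type*} [TopologicalSpace X] [T2Space X] [MeasurableSpace X] [OpensMeasurableSpace X]
  [NormedAddCommGroup F] [NormedSpace ℝ F] {μ : Measure X} {s : Set X}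

theorem integrable_smul_of_tsupport_subset [SecondCountableTopologyEither X F] {u : X → ℝ}
    {v : X → F} (hu : LocallyIntegrableOn u s μ) (hv : Continuous v) (hc : HasCompactSupport v)
    (hs : tsupport v ⊆ s) : Integrable (fun x => u x • v x) μ := by
  refine ((hu.integrableOn_compact_subset hs hc).smul_continuousOn hv.continuousOn
    hc).integrable_of_forall_notMem_eq_zero fun x hx => ?_
  rw [image_eq_zero_of_notMem_tsupport hx, smul_zero]

theorem integrable_smul_of_tsupport_subset' {u : X → F} {v : X → ℝ}
    (hu : LocallyIntegrableOn u s μ) (hv : Continuous v) (hc : HasCompactSupport v)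
    (hs : tsupport v ⊆ s) : Integrable (fun x => v x • u x) μ := by
  refine ((hu.integrableOn_compact_subset hs hc).continuousOn_smul hv.continuousOn
    hc).integrable_of_forall_notMem_eq_zero fun x hx => ?_
  rw [image_eq_zero_of_notMem_tsupport hx, zero_smul]

end LocallyIntegrable

/-! ### Weak gradients -/

section Divergence

variable {E : Type*} [NormedAddCommGroup E] [InnerProductSpace ℝ E] [FiniteDimensional ℝ E]
  [MeasurableSpace E] [BorelSpace E] (μ : Measure E) [μ.IsAddHaarMeasure]

theorem integral_gradient_eq_zero {f : E → ℝ} (hf : ContDiff ℝ 1 f) (hc : HasCompactSupport f) :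
    ∫ x, gradient f x ∂μ = 0 := by
  have hint : Integrable (gradient f) μ :=
    (continuous_gradient hf).integrable_of_hasCompactSupport (hasCompactSupport_gradient hc)
  refine ext_inner_left ℝ fun v => ?_
  have hv : ∀ x, ⟪v, gradient f x⟫ = fderiv ℝ f x v := fun x => by
    rw [real_inner_comm, inner_gradient_left]
  have hint_v : Integrable (fun x => fderiv ℝ f x v) μ := by
    simpa only [hv] using hint.const_inner (𝕜 := ℝ) v
  have := integral_mul_fderiv_eq_neg_fderiv_mul_of_integrable (μ := μ) (f := fun _ => (1 : ℝ))
    (g := f) (v := v) (by simp) (by simpa using hint_v)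
    (by simpa using hf.continuous.integrable_of_hasCompactSupport hc) (by simp)
    (fun x _ => hf.differentiable one_ne_zero x)
  simp only [one_mul, fderiv_fun_const, Pi.zero_apply, zero_apply, zero_mul,
    integral_zero, neg_zero] at this
  rw [← integral_inner hint, inner_zero_right]
  simpa only [hv] using this

theorem integral_smul_gradient_eq_neg {W : Set E} (hW : IsOpen W) {u ψ : E → ℝ}
    (hu : ContDiffOn ℝ 1 u W) (hψ : ContDiff ℝ 1 ψ) (hc : HasCompactSupport ψ)
    (hs : tsupport ψ ⊆ W) :
    ∫ x, u x • gradient ψ x ∂μ = - ∫ x, ψ x • gradient u x ∂μ := by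
  have hprod : ∀ x, gradient (fun y => ψ y * u y) x = ψ x • gradient u x + u x • gradient ψ x := by
    intro x
    by_cases hx : x ∈ W
    · exact gradient_mul (hψ.differentiable one_ne_zero x)
        ((hu.contDiffAt (hW.mem_nhds hx)).differentiableAt one_ne_zero)
    · have hxψ : x ∉ tsupport ψ := fun h => hx (hs h)
      rw [image_eq_zero_of_notMem_tsupport fun h => hxψ (tsupport_mul_subset_left
          (tsupport_gradient_subset _ h)), image_eq_zero_of_notMem_tsupport hxψ,
        image_eq_zero_of_notMem_tsupport fun h => hxψ (tsupport_gradient_subset _ h),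
        zero_smul, smul_zero, add_zero]
  have hzero := integral_gradient_eq_zero μ (contDiff_mul_of_tsupport_subset hW hψ hs hu)
    hc.mul_right
  simp only [hprod] at hzero
  rw [integral_add] at hzero
  · exact eq_neg_of_add_eq_zero_right hzero
  · exact integrable_smul_of_tsupport_subset'
      ((continuousOn_gradient hW hu).locallyIntegrableOn hW.measurableSet) hψ.continuous hc hs
  · exact integrable_smul_of_tsupport_subset (hu.continuousOn.locallyIntegrableOn hW.measurableSet)
      (continuous_gradient hψ) (hasCompactSupport_gradient hc)
      ((tsupport_gradient_subset ψ).trans hs)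

end Divergence

namespace HasWeakGradient

variable {Ω W : Set Plane} {u v χ : Plane → ℝ} {G G' H : Plane → Plane}

theorem of_contDiffOn (hW : IsOpen W) (hu : ContDiffOn ℝ 1 u W) :
    HasWeakGradient W u (gradient u) where
  locallyIntegrableOn := hu.continuousOn.locallyIntegrableOn hW.measurableSet
  locallyIntegrableOn_gradient :=
    (continuousOn_gradient hW hu).locallyIntegrableOn hW.measurableSet
  integral_eq ψ hψ hc hs := by
    rw [setIntegral_eq_integral_of_tsupport_subset ((tsupport_gradient_subset ψ).trans hs)
        fun x hx => by rw [hx, smul_zero],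
      setIntegral_eq_integral_of_tsupport_subset hs fun x hx => by rw [hx, zero_smul]]
    exact integral_smul_gradient_eq_neg volume hW hu (hψ.of_le (by simp)) hc hs

theorem integrable_smul_gradient (h : HasWeakGradient Ω u G) {ψ : Plane → ℝ} (hψ : ContDiff ℝ ∞ ψ)
    (hc : HasCompactSupport ψ) (hs : tsupport ψ ⊆ Ω) : Integrable fun x => u x • gradient ψ x :=
  integrable_smul_of_tsupport_subset h.locallyIntegrableOn
    (continuous_gradient (hψ.of_le (by simp))) (hasCompactSupport_gradient hc)
    ((tsupport_gradient_subset ψ).trans hs)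

theorem integrable_smul (h : HasWeakGradient Ω u G) {ψ : Plane → ℝ} (hψ : ContDiff ℝ ∞ ψ)
    (hc : HasCompactSupport ψ) (hs : tsupport ψ ⊆ Ω) : Integrable fun x => ψ x • G x :=
  integrable_smul_of_tsupport_subset' h.locallyIntegrableOn_gradient hψ.continuous hc hs

theorem integral_eq_univ (h : HasWeakGradient Ω u G) {ψ : Plane → ℝ} (hψ : ContDiff ℝ ∞ ψ)
    (hc : HasCompactSupport ψ) (hs : tsupport ψ ⊆ Ω) :
    ∫ x, u x • gradient ψ x = - ∫ x, ψ x • G x := by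
  have := h.integral_eq ψ hψ hc hs
  rwa [setIntegral_eq_integral_of_tsupport_subset ((tsupport_gradient_subset ψ).trans hs)
      fun x hx => by rw [hx, smul_zero],
    setIntegral_eq_integral_of_tsupport_subset hs fun x hx => by rw [hx, zero_smul]] at this

theorem mono (h : HasWeakGradient Ω u G) (hW : W ⊆ Ω) : HasWeakGradient W u G where
  locallyIntegrableOn := h.1.mono_set hW
  locallyIntegrableOn_gradient := h.2.mono_set hW
  integral_eq ψ hψ hc hs := by
    rw [setIntegral_eq_integral_of_tsupport_subset ((tsupport_gradient_subset ψ).trans hs)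
        fun x hx => by rw [hx, smul_zero],
      setIntegral_eq_integral_of_tsupport_subset hs fun x hx => by rw [hx, zero_smul]]
    exact h.integral_eq_univ hψ hc (hs.trans hW)

theorem ae_eq (hΩ : IsOpen Ω) (h : HasWeakGradient Ω u G) (h' : HasWeakGradient Ω u G') :
    G =ᵐ[volume.restrict Ω] G' := by
  have hdiff := hΩ.ae_eq_zero_of_integral_contDiff_smul_eq_zero (μ := volume)
    (h.locallyIntegrableOn_gradient.sub h'.locallyIntegrableOn_gradient) fun ψ hψ hc hs => by
      simp only [Pi.sub_apply, smul_sub]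
      rw [integral_sub (h.integrable_smul hψ hc hs) (h'.integrable_smul hψ hc hs), sub_eq_zero,
        ← neg_inj, ← h.integral_eq_univ hψ hc hs, h'.integral_eq_univ hψ hc hs]
  rw [Filter.EventuallyEq, ae_restrict_iff' hΩ.measurableSet]
  filter_upwards [hdiff] with x hx hxΩ using sub_eq_zero.1 (hx hxΩ)

theorem add (h : HasWeakGradient Ω u G) (h' : HasWeakGradient Ω v H) :
    HasWeakGradient Ω (u + v) (G + H) where
  locallyIntegrableOn := h.1.add h'.1
  locallyIntegrableOn_gradient := h.2.add h'.2
  integral_eq ψ hψ hc hs := by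
    simp only [Pi.add_apply, add_smul, smul_add]
    rw [integral_add (h.integrable_smul_gradient hψ hc hs).integrableOn
        (h'.integrable_smul_gradient hψ hc hs).integrableOn,
      integral_add (h.integrable_smul hψ hc hs).integrableOn
        (h'.integrable_smul hψ hc hs).integrableOn,
      h.integral_eq ψ hψ hc hs, h'.integral_eq ψ hψ hc hs, neg_add]

theorem neg (h : HasWeakGradient Ω u G) : HasWeakGradient Ω (-u) (-G) where
  locallyIntegrableOn := h.1.neg
  locallyIntegrableOn_gradient := h.2.neg
  integral_eq ψ hψ hc hs := by
    simp only [Pi.neg_apply, neg_smul, smul_neg, integral_neg, h.integral_eq ψ hψ hc hs]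

theorem mul (h : HasWeakGradient Ω u G) (hΩ : IsOpen Ω) (hχ : ContDiff ℝ ∞ χ) :
    HasWeakGradient Ω (χ * u) (fun x => χ x • G x + u x • gradient χ x) := by
  have hgχ := continuous_gradient (hχ.of_le (by simp))
  have hlocχu : LocallyIntegrableOn (χ * u) Ω :=
    h.1.continuousOn_mul hχ.continuous.continuousOn hΩ.isLocallyClosed
  have hlocχG : LocallyIntegrableOn (fun x => χ x • G x) Ω :=
    h.2.continuousOn_smul hΩ.isLocallyClosed hχ.continuous.continuousOn
  have hlocu : LocallyIntegrableOn (fun x => u x • gradient χ x) Ω :=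
    h.1.smul_continuousOn hΩ.isLocallyClosed hgχ.continuousOn
  refine ⟨hlocχu, hlocχG.add hlocu, fun ψ hψ hc hs => ?_⟩
  have hχψ : ContDiff ℝ ∞ fun x => χ x * ψ x := hχ.mul hψ
  have hχψ_supp : tsupport (fun x => χ x * ψ x) ⊆ Ω := tsupport_mul_subset_right.trans hs
  have hintG : Integrable fun x => ψ x • χ x • G x :=
    integrable_smul_of_tsupport_subset' hlocχG hψ.continuous hc hs
  have hint_u : Integrable fun x => ψ x • u x • gradient χ x :=
    integrable_smul_of_tsupport_subset' hlocu hψ.continuous hc hs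
  have hleibniz : ∀ x, (χ * u) x • gradient ψ x =
      u x • gradient (fun y => χ y * ψ y) x - ψ x • u x • gradient χ x := fun x => by
    rw [gradient_mul (hχ.differentiable (by simp) x) (hψ.differentiable (by simp) x),
      Pi.mul_apply]
    module
  have hcomm : ∀ x, (χ x * ψ x) • G x = ψ x • χ x • G x := fun x => by module
  rw [setIntegral_eq_integral_of_tsupport_subset ((tsupport_gradient_subset ψ).trans hs)
      fun x hx => by rw [hx, smul_zero],
    setIntegral_eq_integral_of_tsupport_subset hs fun x hx => by rw [hx, zero_smul]]
  simp only [hleibniz, smul_add]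
  rw [integral_sub (h.integrable_smul_gradient hχψ hc.mul_left hχψ_supp) hint_u,
    integral_add hintG hint_u, h.integral_eq_univ hχψ hc.mul_left hχψ_supp]
  simp only [hcomm, neg_add, sub_eq_add_neg]

theorem extend (h : HasWeakGradient Ω u G) (hΩ : IsOpen Ω) {K : Set Plane} (hK : IsCompact K)
    (hKΩ : K ⊆ Ω) (hu : ∀ x ∉ K, u x = 0) (hG : ∀ x ∉ K, G x = 0) :
    HasWeakGradient univ u G := by
  obtain ⟨η, hη, hηc, hηΩ, hη_one⟩ := exists_cutoff hK hΩ hKΩ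
  refine ⟨((h.1.integrableOn_compact_subset hKΩ hK).integrable_of_forall_notMem_eq_zero
      hu).locallyIntegrable.locallyIntegrableOn _,
    ((h.2.integrableOn_compact_subset hKΩ hK).integrable_of_forall_notMem_eq_zero
      hG).locallyIntegrable.locallyIntegrableOn _, fun ψ hψ _ _ => ?_⟩
  have hgrad : ∀ x, u x • gradient (fun y => η y * ψ y) x = u x • gradient ψ x := fun x => by
    by_cases hx : x ∈ K
    · have : (fun y => η y * ψ y) =ᶠ[𝓝 x] ψ := by
        filter_upwards [hη_one.filter_mono (nhds_le_nhdsSet hx)] with y hy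
        rw [hy, one_mul]
      rw [this.gradient_eq]
    · rw [hu x hx, zero_smul, zero_smul]
  have hval : ∀ x, (η x * ψ x) • G x = ψ x • G x := fun x => by
    by_cases hx : x ∈ K
    · rw [hη_one.self_of_nhdsSet x hx, one_mul]
    · rw [hG x hx, smul_zero, smul_zero]
  simpa only [hgrad, hval, setIntegral_univ] using
    h.integral_eq_univ (hη.mul hψ) hηc.mul_right (tsupport_mul_subset_left.trans hηΩ)

end HasWeakGradient

namespace HasH1Gradient

variable {Ω W : Set Plane} {u v χ : Plane → ℝ} {G H : Plane → Plane}

theorem mono (h : HasH1Gradient Ω u G) (hW : W ⊆ Ω) : HasH1Gradient W u G where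
  memLp := h.memLp.mono_measure (Measure.restrict_mono_set volume hW)
  memLp_gradient := h.memLp_gradient.mono_measure (Measure.restrict_mono_set volume hW)
  weak := h.weak.mono hW

theorem add (h : HasH1Gradient Ω u G) (h' : HasH1Gradient Ω v H) :
    HasH1Gradient Ω (u + v) (G + H) where
  memLp := h.memLp.add h'.memLp
  memLp_gradient := h.memLp_gradient.add h'.memLp_gradient
  weak := h.weak.add h'.weak

theorem neg (h : HasH1Gradient Ω u G) : HasH1Gradient Ω (-u) (-G) where
  memLp := h.memLp.neg
  memLp_gradient := h.memLp_gradient.neg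
  weak := h.weak.neg

theorem mul (h : HasH1Gradient Ω u G) (hΩ : IsOpen Ω) (hχ : ContDiff ℝ ∞ χ)
    (hχc : HasCompactSupport χ) :
    HasH1Gradient Ω (χ * u) (fun x => χ x • G x + u x • gradient χ x) := by
  have hgχ := continuous_gradient (hχ.of_le (by simp))
  have hχ_top : MemLp χ ⊤ (volume.restrict Ω) :=
    (hχ.continuous.memLp_top_of_hasCompactSupport hχc volume).restrict Ω
  have hgχ_top : MemLp (gradient χ) ⊤ (volume.restrict Ω) :=
    (hgχ.memLp_top_of_hasCompactSupport (hasCompactSupport_gradient hχc) volume).restrict Ω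
  exact ⟨h.memLp.mul' hχ_top, (h.memLp_gradient.smul hχ_top).add (hgχ_top.smul h.memLp),
    h.weak.mul hΩ hχ⟩

theorem extend (h : HasH1Gradient Ω u G) (hΩ : IsOpen Ω) {K : Set Plane} (hK : IsCompact K)
    (hKΩ : K ⊆ Ω) (hu : ∀ x ∉ K, u x = 0) (hG : ∀ x ∉ K, G x = 0) :
    HasH1Gradient univ u G := by
  have memLp_univ {F : Type} [NormedAddCommGroup F] {f : Plane → F} (h0 : ∀ x ∉ K, f x = 0)
      (hf : MemLp f 2 (volume.restrict Ω)) : MemLp f 2 (volume.restrict univ) := by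
    rw [Measure.restrict_univ, ← indicator_eq_self.2 fun x hx => by_contra fun hxΩ =>
      hx (h0 x fun hxK => hxΩ (hKΩ hxK))]
    exact (memLp_indicator_iff_restrict hΩ.measurableSet).2 hf
  exact ⟨memLp_univ hu h.memLp, memLp_univ hG h.memLp_gradient, h.weak.extend hΩ hK hKΩ hu hG⟩

end HasH1Gradient

/-! ### Mollification -/

section Minkowski

variable {X Y F : Type*} [MeasurableSpace X] [MeasurableSpace Y] {μ : Measure X} [SFinite μ]
  {ν : Measure Y} [IsProbabilityMeasure ν] [NormedAddCommGroup F] [NormedSpace ℝ F]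

theorem enorm_integral_rpow_le {f : Y → F} (hf : AEStronglyMeasurable f ν) {q : ℝ} (hq : 1 ≤ q) :
    ‖∫ y, f y ∂ν‖ₑ ^ q ≤ ∫⁻ y, ‖f y‖ₑ ^ q ∂ν := by
  have hq0 : 0 < q := one_pos.trans_le hq
  have hexp := eLpNorm'_le_eLpNorm'_of_exponent_le one_pos hq ν hf
  simp only [eLpNorm', ENNReal.rpow_one, div_one] at hexp
  rw [← ENNReal.le_rpow_inv_iff hq0, ← one_div]
  exact (enorm_integral_le_lintegral_enorm f).trans hexp

theorem eLpNorm_integral_le {p : ENNReal} (hp : 1 ≤ p) (hp_top : p ≠ ⊤) {f : X → Y → F}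
    (hf : AEStronglyMeasurable (Function.uncurry f) (μ.prod ν)) {C : ENNReal}
    (hC : ∀ᵐ y ∂ν, eLpNorm (fun x => f x y) p μ ≤ C) :
    eLpNorm (fun x => ∫ y, f x y ∂ν) p μ ≤ C := by
  have hp0 : p ≠ 0 := (one_pos.trans_le hp).ne'
  have hq : 1 ≤ p.toReal := by simpa using ENNReal.toReal_mono hp_top hp
  have le_iff (g : X → F) : eLpNorm g p μ ≤ C ↔ ∫⁻ x, ‖g x‖ₑ ^ p.toReal ∂μ ≤ C ^ p.toReal := by
    rw [eLpNorm_eq_lintegral_rpow_enorm_toReal hp0 hp_top, one_div,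
      ENNReal.rpow_inv_le_iff (one_pos.trans_le hq)]
  simp only [le_iff] at hC ⊢
  calc ∫⁻ x, ‖∫ y, f x y ∂ν‖ₑ ^ p.toReal ∂μ
      ≤ ∫⁻ x, ∫⁻ y, ‖f x y‖ₑ ^ p.toReal ∂ν ∂μ := by
        refine lintegral_mono_ae ?_
        filter_upwards [hf.prodMk_left] with x hx using enorm_integral_rpow_le hx hq
    _ = ∫⁻ y, ∫⁻ x, ‖f x y‖ₑ ^ p.toReal ∂μ ∂ν :=
        lintegral_lintegral_swap (hf.enorm.pow_const _)
    _ ≤ ∫⁻ _, C ^ p.toReal ∂ν := lintegral_mono_ae hC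
    _ = C ^ p.toReal := by rw [lintegral_const, measure_univ, mul_one]

end Minkowski

section BumpConvolution

open scoped Convolution
open ContinuousLinearMap (lsmul)

variable {E F : Type*} [NormedAddCommGroup E] [NormedSpace ℝ E] [FiniteDimensional ℝ E]
  [MeasurableSpace E] [BorelSpace E] {μ : Measure E} [NormedAddCommGroup F] {p : ENNReal}
  {u : E → F}

/-- The probability measure whose density is the normalised bump function `b`: convolution with
`b.normed μ` is an average with respect to it. -/
def bumpMeasure (b : ContDiffBump (0 : E)) (μ : Measure E) : Measure E :=
  μ.withDensity fun y => ENNReal.ofReal (b.normed μ y)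

theorem measurable_ofReal_normed (b : ContDiffBump (0 : E)) :
    Measurable fun y => ENNReal.ofReal (b.normed μ y) :=
  b.continuous_normed.measurable.ennreal_ofReal

theorem convolution_normed_apply [NormedSpace ℝ F] (b : ContDiffBump (0 : E)) (x : E) :
    (b.normed μ ⋆[lsmul ℝ ℝ, μ] u) x = ∫ y, u (x - y) ∂(bumpMeasure b μ) := by
  rw [bumpMeasure, integral_withDensity_eq_integral_toReal_smul (measurable_ofReal_normed b)
    (by simp)]
  simp only [ENNReal.toReal_ofReal (b.nonneg_normed _), convolution_def,
    ContinuousLinearMap.lsmul_apply]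

variable [μ.IsAddHaarMeasure]

theorem tendsto_eLpNorm_translate_sub (hp : 1 ≤ p) (hp_top : p ≠ ⊤) (hu : MemLp u p μ) :
    Tendsto (fun y => eLpNorm (fun x => u (x - y) - u x) p μ) (𝓝 0) (𝓝 0) := by
  have : Fact (1 ≤ p) := ⟨hp⟩
  have : Fact (p ≠ ⊤) := ⟨hp_top⟩
  have hcont : Continuous fun y : E => (DomAddAct.mk (-y)) +ᵥ hu.toLp u := by fun_prop
  have hlim := (hcont.edist (continuous_const (y := hu.toLp u))).tendsto 0
  rw [neg_zero, DomAddAct.mk_zero, zero_vadd, edist_self] at hlim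
  refine hlim.congr fun y => ?_
  have hm : MemLp (fun x => u (-y +ᵥ x)) p μ :=
    hu.comp_measurePreserving (measurePreserving_vadd (-y) μ)
  rw [DomAddAct.mk_vadd_toLp, Lp.edist_toLp_toLp _ _ hm hu]
  simp only [vadd_eq_add, neg_add_eq_sub, Pi.sub_def]

instance (b : ContDiffBump (0 : E)) : IsProbabilityMeasure (bumpMeasure b μ) where
  measure_univ := by
    rw [bumpMeasure, withDensity_apply _ MeasurableSet.univ, setLIntegral_univ,
      ← ofReal_integral_eq_lintegral_ofReal b.integrable_normed
        (Eventually.of_forall b.nonneg_normed), b.integral_normed, ENNReal.ofReal_one]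

theorem ae_bumpMeasure_mem_ball (b : ContDiffBump (0 : E)) :
    ∀ᵐ y ∂(bumpMeasure b μ), y ∈ Metric.ball 0 b.rOut := by
  rw [bumpMeasure, ae_withDensity_iff (measurable_ofReal_normed b)]
  refine Eventually.of_forall fun y hy => ?_
  rw [← b.support_normed_eq (μ := μ), Function.mem_support]
  exact fun h => hy (by rw [h, ENNReal.ofReal_zero])

theorem aestronglyMeasurable_comp_sub (b : ContDiffBump (0 : E)) (hu : AEStronglyMeasurable u μ) :
    AEStronglyMeasurable (fun z : E × E => u (z.1 - z.2)) (μ.prod (bumpMeasure b μ)) :=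
  hu.comp_quasiMeasurePreserving
    (quasiMeasurePreserving_sub_of_right_invariant μ (bumpMeasure b μ))

variable [NormedSpace ℝ F]

theorem integrable_comp_sub_bumpMeasure (b : ContDiffBump (0 : E)) (hu : LocallyIntegrable u μ)
    (x : E) : Integrable (fun y => u (x - y)) (bumpMeasure b μ) := by
  rw [bumpMeasure, integrable_withDensity_iff_integrable_smul' (measurable_ofReal_normed b)
    (by simp)]
  simp only [ENNReal.toReal_ofReal (b.nonneg_normed _)]
  exact b.hasCompactSupport_normed.convolutionExists_left (lsmul ℝ ℝ) b.continuous_normed hu x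

theorem eLpNorm_convolution_normed_sub_le [CompleteSpace F] (b : ContDiffBump (0 : E))
    (hp : 1 ≤ p) (hp_top : p ≠ ⊤) (hu : MemLp u p μ) {C : ENNReal}
    (hC : ∀ y ∈ Metric.ball 0 b.rOut, eLpNorm (fun x => u (x - y) - u x) p μ ≤ C) :
    eLpNorm ((b.normed μ ⋆[lsmul ℝ ℝ, μ] u) - u) p μ ≤ C := by
  have hsub : (b.normed μ ⋆[lsmul ℝ ℝ, μ] u) - u =
      fun x => ∫ y, (u (x - y) - u x) ∂(bumpMeasure b μ) := by
    funext x
    rw [integral_sub (integrable_comp_sub_bumpMeasure b (hu.locallyIntegrable hp) x)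
      (integrable_const _), integral_const, probReal_univ, one_smul, Pi.sub_apply,
      convolution_normed_apply]
  rw [hsub]
  refine eLpNorm_integral_le hp hp_top
    ((aestronglyMeasurable_comp_sub b hu.1).sub hu.1.comp_fst) ?_
  filter_upwards [ae_bumpMeasure_mem_ball b] with y hy using hC y hy

theorem memLp_convolution_normed (b : ContDiffBump (0 : E)) (hp : 1 ≤ p) (hp_top : p ≠ ⊤)
    (hu : MemLp u p μ) : MemLp (b.normed μ ⋆[lsmul ℝ ℝ, μ] u) p μ := by
  have hconv : (b.normed μ ⋆[lsmul ℝ ℝ, μ] u) = fun x => ∫ y, u (x - y) ∂(bumpMeasure b μ) :=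
    funext (convolution_normed_apply b)
  refine ⟨(b.hasCompactSupport_normed.continuous_convolution_left (lsmul ℝ ℝ) b.continuous_normed
    (hu.locallyIntegrable hp)).aestronglyMeasurable, lt_of_le_of_lt ?_ hu.2⟩
  rw [hconv]
  exact eLpNorm_integral_le hp hp_top (aestronglyMeasurable_comp_sub b hu.1)
    (Eventually.of_forall fun y =>
      (eLpNorm_comp_measurePreserving hu.1 (measurePreserving_sub_right μ y)).le)

theorem tendsto_eLpNorm_convolution_normed_sub [CompleteSpace F] {ι : Type*} {l : Filter ι}
    {b : ι → ContDiffBump (0 : E)} (hb : Tendsto (fun i => (b i).rOut) l (𝓝 0)) (hp : 1 ≤ p)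
    (hp_top : p ≠ ⊤) (hu : MemLp u p μ) :
    Tendsto (fun i => eLpNorm (((b i).normed μ ⋆[lsmul ℝ ℝ, μ] u) - u) p μ) l (𝓝 0) := by
  refine ENNReal.tendsto_nhds_zero.2 fun ε hε => ?_
  obtain ⟨δ, hδ, hball⟩ := Metric.eventually_nhds_iff_ball.1
    (ENNReal.tendsto_nhds_zero.1 (tendsto_eLpNorm_translate_sub hp hp_top hu) ε hε)
  filter_upwards [hb.eventually_lt_const hδ] with i hi
  exact eLpNorm_convolution_normed_sub_le (b i) hp hp_top hu fun y hy =>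
    hball y (Metric.ball_subset_ball hi.le hy)

end BumpConvolution

section GradientConvolution

open scoped Convolution
open ContinuousLinearMap (lsmul)

theorem gradient_convolution_apply {E : Type*} [NormedAddCommGroup E] [InnerProductSpace ℝ E]
    [FiniteDimensional ℝ E] [MeasurableSpace E] [BorelSpace E] {μ : Measure E}
    [μ.IsAddHaarMeasure] {ρ u : E → ℝ} (hρ : ContDiff ℝ 1 ρ) (hc : HasCompactSupport ρ)
    (hu : LocallyIntegrable u μ) (x : E) :
    gradient (ρ ⋆[lsmul ℝ ℝ, μ] u) x = ∫ y, u y • gradient ρ (x - y) ∂μ := by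
  have hderiv := hc.hasFDerivAt_convolution_left (lsmul ℝ ℝ) hρ hu x
  have hint : Integrable (fun y => u y • gradient ρ (x - y)) μ :=
    integrable_smul_of_tsupport_subset (locallyIntegrableOn_univ.2 hu)
      ((continuous_gradient hρ).comp (continuous_const.sub continuous_id))
      ((hasCompactSupport_gradient hc).comp_homeomorph (Homeomorph.subLeft x)) (subset_univ _)
  have hint' := (hc.fderiv (𝕜 := ℝ)).convolutionExists_left
    (ContinuousLinearMap.precompL E (lsmul ℝ ℝ)) (hρ.continuous_fderiv one_ne_zero) hu x
  refine ext_inner_right ℝ fun v => ?_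
  rw [inner_gradient_left, hderiv.fderiv, convolution_def, ContinuousLinearMap.integral_apply hint',
    real_inner_comm, ← integral_inner hint, ← integral_sub_left_eq_self _ μ x]
  simp only [sub_sub_cancel, ContinuousLinearMap.precompL_apply, ContinuousLinearMap.lsmul_apply,
    real_inner_smul_right, inner_gradient_right, conj_trivial, smul_eq_mul, mul_comm]

theorem HasWeakGradient.gradient_convolution {u : Plane → ℝ} {g : Plane → Plane}
    (h : HasWeakGradient univ u g) {ρ : Plane → ℝ} (hρ : ContDiff ℝ ∞ ρ)
    (hc : HasCompactSupport ρ) :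
    gradient (ρ ⋆[lsmul ℝ ℝ, volume] u) = ρ ⋆[lsmul ℝ ℝ, volume] g := by
  funext x
  have hweak := h.integral_eq (fun y => ρ (x - y)) (hρ.comp (contDiff_const.sub contDiff_id))
    (hc.comp_homeomorph (Homeomorph.subLeft x)) (subset_univ _)
  simp only [setIntegral_univ, gradient_comp_const_sub (hρ.differentiable (by simp) _), smul_neg,
    integral_neg, neg_inj] at hweak
  rw [gradient_convolution_apply (hρ.of_le (by simp)) hc (locallyIntegrableOn_univ.1 h.1), hweak,
    convolution_def, ← integral_sub_left_eq_self _ volume x]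
  simp only [sub_sub_cancel, ContinuousLinearMap.lsmul_apply]

theorem HasH1Gradient.convolution_normed {u : Plane → ℝ} {g : Plane → Plane}
    (h : HasH1Gradient univ u g) (b : ContDiffBump (0 : Plane)) :
    HasH1Gradient univ (b.normed volume ⋆[lsmul ℝ ℝ, volume] u)
      (b.normed volume ⋆[lsmul ℝ ℝ, volume] g) := by
  have memLp_conv {F : Type} [NormedAddCommGroup F] [NormedSpace ℝ F] {f : Plane → F}
      (hf : MemLp f 2 (volume.restrict univ)) :
      MemLp (b.normed volume ⋆[lsmul ℝ ℝ, volume] f) 2 (volume.restrict univ) := by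
    rw [Measure.restrict_univ] at hf ⊢
    exact memLp_convolution_normed b one_le_two (by simp) hf
  refine ⟨memLp_conv h.memLp, memLp_conv h.memLp_gradient, ?_⟩
  rw [← h.weak.gradient_convolution b.contDiff_normed b.hasCompactSupport_normed]
  exact .of_contDiffOn isOpen_univ (b.hasCompactSupport_normed.contDiff_convolution_left (n := 1)
    (lsmul ℝ ℝ) b.contDiff_normed (locallyIntegrableOn_univ.1 h.weak.1)).contDiffOn

end GradientConvolution

/-! ### Traces of functions that are continuous up to the boundary -/

section Trace

open scoped Convolution
open ContinuousLinearMap (lsmul)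

variable {Ω U : Set Plane} {φ : Plane → ℝ} {H : Plane → Plane}

theorem notMem_of_mem_frontier {X : Type*} [TopologicalSpace X] {s : Set X} {x : X} (hs : IsOpen s)
    (hx : x ∈ frontier s) : x ∉ s := (hs.frontier_eq ▸ hx : x ∈ closure s \ s).2

theorem isCompact_frontier_of_isBounded {X : Type*} [PseudoMetricSpace X] [ProperSpace X]
    {s : Set X} (hs : Bornology.IsBounded s) : IsCompact (frontier s) :=
  hs.isCompact_closure.of_isClosed_subset isClosed_frontier frontier_subset_closure

theorem continuousOn_closure_one_sub_mul {χ : Plane → ℝ} (hU : IsOpen U) (hχ : Continuous χ)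
    (hχ_one : ∀ᶠ x in 𝓝ˢ (closure Ω \ U), χ x = 1) (hφ : ContinuousOn φ (U ∩ closure Ω)) :
    ContinuousOn (fun x => (1 - χ x) * φ x) (closure Ω) := by
  intro x hx
  by_cases hxU : x ∈ U
  · have hφx : ContinuousWithinAt φ (closure Ω) x :=
      (continuousWithinAt_inter' (mem_nhdsWithin_of_mem_nhds (hU.mem_nhds hxU))).1
        (by simpa only [inter_comm] using hφ x ⟨hxU, hx⟩)
    exact (continuous_const.sub hχ).continuousWithinAt.mul hφx
  · have hzero : (fun x => (1 - χ x) * φ x) =ᶠ[𝓝 x] fun _ => 0 := by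
      filter_upwards [hχ_one.filter_mono (nhds_le_nhdsSet (mem_sdiff_of_mem hx hxU))] with y hy
      rw [hy, sub_self, zero_mul]
    exact (continuousAt_const.congr hzero.symm).continuousWithinAt

theorem exists_compactly_supported_part (hΩ : IsOpen Ω) (hb : Bornology.IsBounded Ω)
    (hU : IsOpen U) (hfU : frontier Ω ⊆ U) (h : HasH1Gradient Ω φ H)
    (hφ : ContinuousOn φ (U ∩ closure Ω)) :
    ∃ (K : Set Plane) (u : Plane → ℝ) (g : Plane → Plane), IsCompact K ∧ K ⊆ Ω ∧
      HasH1Gradient univ u g ∧ (∀ x ∉ K, u x = 0) ∧ ContinuousOn (φ - u) (closure Ω) := by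
  have hsub : closure Ω \ U ⊆ Ω := fun x hx => by_contra fun hxΩ =>
    hx.2 (hfU ⟨hx.1, by rwa [hΩ.interior_eq]⟩)
  obtain ⟨χ, hχ, hχc, hχΩ, hχ_one⟩ := exists_cutoff (hb.isCompact_closure.diff hU) hΩ hsub
  have hχ_zero : ∀ x ∉ tsupport χ, χ x = 0 := fun x => image_eq_zero_of_notMem_tsupport
  have hgχ_zero : ∀ x ∉ tsupport χ, gradient χ x = 0 := fun x hx =>
    image_eq_zero_of_notMem_tsupport fun hx' => hx (tsupport_gradient_subset χ hx')
  have hu_zero : ∀ x ∉ tsupport χ, (χ * φ) x = 0 := fun x hx => by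
    rw [Pi.mul_apply, hχ_zero x hx, zero_mul]
  refine ⟨tsupport χ, χ * φ, _, hχc, hχΩ, (h.mul hΩ hχ hχc).extend hΩ hχc hχΩ hu_zero
    fun x hx => by rw [hχ_zero x hx, hgχ_zero x hx, zero_smul, smul_zero, add_zero], hu_zero,
    (continuousOn_closure_one_sub_mul hU hχ.continuous hχ_one hφ).congr fun x _ => ?_⟩
  rw [Pi.sub_apply, Pi.mul_apply]
  ring

theorem eventually_normed_convolution_eq_zero {K : Set Plane} (hK : IsCompact K) (hΩ : IsOpen Ω)
    (hKΩ : K ⊆ Ω) {u : Plane → ℝ} (hu : ∀ x ∉ K, u x = 0) {ι : Type*} {l : Filter ι}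
    {b : ι → ContDiffBump (0 : Plane)} (hb : Tendsto (fun i => (b i).rOut) l (𝓝 0)) :
    ∀ᶠ i in l, ∀ x ∉ Ω, ((b i).normed volume ⋆[lsmul ℝ ℝ, volume] u) x = 0 := by
  obtain ⟨δ, hδ, hthick⟩ := hK.exists_thickening_subset_open hΩ hKΩ
  filter_upwards [hb.eventually_lt_const hδ] with i hi x hx
  have hux : u x = 0 := hu x fun hxK => hx (hKΩ hxK)
  rw [(b i).normed_convolution_eq_right fun y hy => ?_, hux]
  rw [hux]
  refine hu y fun hyK => hx (hthick (Metric.mem_thickening_iff.2 ⟨y, hyK, ?_⟩))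
  exact (dist_comm x y).trans_lt ((Metric.mem_ball.1 hy).trans hi)

/-- A sequence of bump functions whose supports shrink to the origin. -/
def shrinkingBump (n : ℕ) : ContDiffBump (0 : Plane) where
  rIn := 1 / (n + 1) / 2
  rOut := 1 / (n + 1)
  rIn_pos := by positivity
  rIn_lt_rOut := half_lt_self (by positivity)

theorem tendsto_rOut_shrinkingBump : Tendsto (fun n => (shrinkingBump n).rOut) atTop (𝓝 0) :=
  tendsto_one_div_add_atTop_nhds_zero_nat

theorem memLp_boundaryMeasure_of_continuousOn (hb : Bornology.IsBounded Ω)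
    [IsFiniteMeasure (boundaryMeasure Ω)] {E : Type*} [NormedAddCommGroup E] {f : Plane → E}
    (hf : ContinuousOn f (frontier Ω)) (p : ENNReal) : MemLp f p (boundaryMeasure Ω) := by
  have hc := isCompact_frontier_of_isBounded hb
  obtain ⟨C, hC⟩ := hc.exists_bound_of_continuousOn hf
  refine MemLp.of_bound (hf.aestronglyMeasurable_of_isCompact hc hc.measurableSet) C ?_
  rw [boundaryMeasure, ae_restrict_iff' hc.measurableSet]
  exact Eventually.of_forall hC

theorem hasTrace_self (hΩ : IsOpen Ω) (hb : Bornology.IsBounded Ω)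
    [IsFiniteMeasure (boundaryMeasure Ω)] (hU : IsOpen U) (hfU : frontier Ω ⊆ U)
    (h : HasH1Gradient Ω φ H) (hφ : ContinuousOn φ (U ∩ closure Ω)) : HasTrace Ω φ φ := by
  obtain ⟨K, u, g, hK, hKΩ, hu, hu_zero, hcont⟩ :=
    exists_compactly_supported_part hΩ hb hU hfU h hφ
  have hconv n := hu.convolution_normed (shrinkingBump n)
  have tendsto_conv {F : Type} [NormedAddCommGroup F] [NormedSpace ℝ F] [CompleteSpace F]
      {f f₀ : Plane → F} (hf : MemLp f 2 (volume.restrict univ)) :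
      Tendsto (fun n => eLpNorm (f₀ + (((shrinkingBump n).normed volume ⋆[lsmul ℝ ℝ, volume] f) +
        -f) - f₀) 2 (volume.restrict Ω)) atTop (𝓝 0) := by
    rw [Measure.restrict_univ] at hf
    simp only [add_sub_cancel_left, ← sub_eq_add_neg]
    exact tendsto_of_tendsto_of_tendsto_of_le_of_le tendsto_const_nhds
      (tendsto_eLpNorm_convolution_normed_sub tendsto_rOut_shrinkingBump one_le_two (by simp) hf)
      (fun _ => zero_le) fun n => eLpNorm_mono_measure _ Measure.restrict_le_self
  refine ⟨memLp_boundaryMeasure_of_continuousOn hb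
    (hφ.mono fun x hx => ⟨hfU hx, frontier_subset_closure hx⟩) 2, H, _, _, h,
    fun n => h.add (((hconv n).add hu.neg).mono (subset_univ _)), fun n => ?_,
    tendsto_conv hu.memLp, tendsto_conv hu.memLp_gradient, ?_⟩
  · have hconv_cont : Continuous ((shrinkingBump n).normed volume ⋆[lsmul ℝ ℝ, volume] u) :=
      (shrinkingBump n).hasCompactSupport_normed.continuous_convolution_left (lsmul ℝ ℝ)
        (shrinkingBump n).continuous_normed (locallyIntegrableOn_univ.1 hu.weak.1)
    refine (hcont.add hconv_cont.continuousOn).congr fun x _ => ?_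
    simp only [Pi.add_apply, Pi.sub_apply, Pi.neg_apply]
    ring
  · refine tendsto_const_nhds.congr' ?_
    filter_upwards [eventually_normed_convolution_eq_zero hK hΩ hKΩ hu_zero
      tendsto_rOut_shrinkingBump] with n hn
    rw [eq_comm, eLpNorm_congr_ae (g := 0), eLpNorm_zero]
    rw [boundaryMeasure, Filter.EventuallyEq, ae_restrict_iff' isClosed_frontier.measurableSet]
    refine Eventually.of_forall fun x hx => ?_
    have hxΩ : x ∉ Ω := notMem_of_mem_frontier hΩ hx
    simp only [Pi.add_apply, Pi.sub_apply, Pi.neg_apply, Pi.zero_apply, hn x hxΩ,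
      hu_zero x fun hxK => hxΩ (hKΩ hxK), neg_zero, add_zero, sub_self]

end Trace

/-! ### Length of `C¹` curves -/

theorem eq_withDensity_of_tendsto_measureReal_Ioc_div {μ : Measure ℝ} [IsLocallyFiniteMeasure μ]
    [NullSingletonClass μ] {φ : ℝ → ℝ} (hφ : Continuous φ) (hφ_nonneg : ∀ x, 0 ≤ φ x)
    (h : ∀ x, Tendsto (fun y => μ.real (Ioc x y) / (y - x)) (𝓝[>] x) (𝓝 (φ x))) :
    μ = volume.withDensity fun x => ENNReal.ofReal (φ x) := by
  have hint a b : IntervalIntegrable (fun _ => (1 : ℝ)) μ a b :=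
    continuous_const.intervalIntegrable a b
  have hinterval {a b : ℝ} (hab : a ≤ b) : ∫ _ in a..b, (1 : ℝ) ∂μ = μ.real (Ioc a b) := by
    rw [intervalIntegral.integral_const', Ioc_eq_empty (not_lt.2 hab), measureReal_empty, sub_zero,
      smul_eq_mul, mul_one]
  refine Measure.ext_of_Ioc _ _ fun a b hab => ?_
  have hderiv x : HasDerivWithinAt (fun t => ∫ _ in a..t, (1 : ℝ) ∂μ) (φ x) (Ioi x) x := by
    rw [hasDerivWithinAt_iff_tendsto_slope' self_notMem_Ioi]
    refine (h x).congr' ?_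
    filter_upwards [self_mem_nhdsWithin] with y hy
    rw [slope_def_field, intervalIntegral.integral_interval_sub_left (hint a y) (hint a x),
      hinterval (le_of_lt hy)]
  have hFTC := intervalIntegral.integral_eq_sub_of_hasDeriv_right (a := a) (b := b)
    (intervalIntegral.continuous_primitive hint a).continuousOn (fun x _ => hderiv x)
    (hφ.intervalIntegrable a b)
  rw [intervalIntegral.integral_same, sub_zero, hinterval hab.le,
    intervalIntegral.integral_of_le hab.le] at hFTC
  rw [withDensity_apply _ measurableSet_Ioc, ← ofReal_integral_eq_lintegral_ofReal
    hφ.integrableOn_Ioc (Eventually.of_forall hφ_nonneg), hFTC,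
    ofReal_measureReal measure_Ioc_lt_top.ne]

section CurveLength

variable {E : Type*} [NormedAddCommGroup E] [MeasurableSpace E] [BorelSpace E] {g : ℝ → E} {a b : ℝ}

theorem ofReal_norm_sub_le_comap_hausdorffMeasure_Ioc (hg : Continuous g)
    (hinj : Function.Injective g) (hab : a ≤ b) :
    ENNReal.ofReal ‖g b - g a‖ ≤ (Measure.hausdorffMeasure 1).comap g (Ioc a b) := by
  have hlip : LipschitzWith 1 fun x : E => dist x (g a) := LipschitzWith.dist_left (g a)
  have hsub : Ioc 0 ‖g b - g a‖ ⊆ (fun x : E => dist x (g a)) '' (g '' Ioc a b) := by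
    intro y hy
    have hcont : ContinuousOn (fun t => dist (g t) (g a)) (Icc a b) :=
      (hg.dist continuous_const).continuousOn
    have hy' : y ∈ Icc (dist (g a) (g a)) (dist (g b) (g a)) := by
      rw [dist_self, dist_eq_norm]
      exact Ioc_subset_Icc_self hy
    obtain ⟨t, ht, rfl⟩ := intermediate_value_Icc hab hcont hy'
    have hat : a ≠ t := by
      rintro rfl
      simp only [dist_self, mem_Ioc, lt_self_iff_false, false_and] at hy
    exact ⟨g t, ⟨t, ⟨lt_of_le_of_ne ht.1 hat, ht.2⟩, rfl⟩, rfl⟩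
  calc ENNReal.ofReal ‖g b - g a‖ = volume (Ioc 0 ‖g b - g a‖) := by rw [Real.volume_Ioc, sub_zero]
    _ ≤ volume ((fun x : E => dist x (g a)) '' (g '' Ioc a b)) := measure_mono hsub
    _ ≤ Measure.hausdorffMeasure 1 (g '' Ioc a b) := by
        simpa only [ENNReal.coe_one, ENNReal.one_rpow, one_mul, hausdorffMeasure_real] using
          hlip.hausdorffMeasure_image_le zero_le_one (g '' Ioc a b)
    _ = (Measure.hausdorffMeasure 1).comap g (Ioc a b) :=
        ((hg.measurableEmbedding hinj).comap_apply _ _).symm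

variable [NormedSpace ℝ E]

theorem comap_hausdorffMeasure_Icc_le (hg : ContDiff ℝ 1 g) (hinj : Function.Injective g) {C : ℝ}
    (hC : ∀ x ∈ Icc a b, ‖deriv g x‖ ≤ C) :
    (Measure.hausdorffMeasure 1).comap g (Icc a b) ≤ ENNReal.ofReal C * ENNReal.ofReal (b - a) := by
  have hlip : LipschitzOnWith C.toNNReal g (Icc a b) := by
    refine (convex_Icc a b).lipschitzOnWith_of_nnnorm_deriv_le
      (fun x _ => hg.differentiable one_ne_zero x) fun x hx => ?_
    rw [← NNReal.coe_le_coe, coe_nnnorm]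
    exact (hC x hx).trans (Real.le_coe_toNNReal C)
  calc (Measure.hausdorffMeasure 1).comap g (Icc a b)
      = Measure.hausdorffMeasure 1 (g '' Icc a b) :=
        (hg.continuous.measurableEmbedding hinj).comap_apply _ _
    _ ≤ (C.toNNReal : ENNReal) ^ (1 : ℝ) * Measure.hausdorffMeasure 1 (Icc a b) :=
        hlip.hausdorffMeasure_image_le zero_le_one
    _ = ENNReal.ofReal C * ENNReal.ofReal (b - a) := by
        rw [hausdorffMeasure_real, Real.volume_Icc, ENNReal.rpow_one]
        rfl

theorem comap_hausdorffMeasure_Icc_lt_top (hg : ContDiff ℝ 1 g) (hinj : Function.Injective g) :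
    (Measure.hausdorffMeasure 1).comap g (Icc a b) < ⊤ := by
  obtain ⟨C, hC⟩ := isCompact_Icc.exists_bound_of_continuousOn (s := Icc a b)
    (hg.continuous_deriv le_rfl).continuousOn
  exact (comap_hausdorffMeasure_Icc_le hg hinj hC).trans_lt
    (ENNReal.mul_lt_top ENNReal.ofReal_lt_top ENNReal.ofReal_lt_top)

theorem comap_hausdorffMeasure_Ioc_ne_top (hg : ContDiff ℝ 1 g) (hinj : Function.Injective g) :
    (Measure.hausdorffMeasure 1).comap g (Ioc a b) ≠ ⊤ :=
  measure_ne_top_of_subset Ioc_subset_Icc_self (comap_hausdorffMeasure_Icc_lt_top hg hinj).ne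

theorem tendsto_comap_hausdorffMeasure_Ioc_div (hg : ContDiff ℝ 1 g) (hinj : Function.Injective g)
    (x : ℝ) :
    Tendsto (fun y => ((Measure.hausdorffMeasure 1).comap g).real (Ioc x y) / (y - x)) (𝓝[>] x)
      (𝓝 ‖deriv g x‖) := by
  have hslope : Tendsto (fun y => ‖slope g x y‖) (𝓝[>] x) (𝓝 ‖deriv g x‖) :=
    ((hasDerivWithinAt_iff_tendsto_slope' self_notMem_Ioi).1
      (hg.differentiable one_ne_zero x).hasDerivAt.hasDerivWithinAt).norm
  refine tendsto_order.2 ⟨fun c hc => ?_, fun c hc => ?_⟩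
  · filter_upwards [hslope.eventually_const_lt hc, self_mem_nhdsWithin] with y hy (hxy : x < y)
    refine hy.trans_le ?_
    rw [slope_def_module, norm_smul, norm_inv, Real.norm_of_nonneg (sub_nonneg.2 hxy.le),
      inv_mul_eq_div]
    exact div_le_div_of_nonneg_right ((ENNReal.ofReal_le_iff_le_toReal
      (comap_hausdorffMeasure_Ioc_ne_top hg hinj)).1
      (ofReal_norm_sub_le_comap_hausdorffMeasure_Ioc hg.continuous hinj hxy.le))
      (sub_nonneg.2 hxy.le)
  · obtain ⟨d, hd, hdc⟩ := exists_between hc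
    have hd_nonneg : 0 ≤ d := (norm_nonneg _).trans hd.le
    obtain ⟨r, hr, hball⟩ := Metric.eventually_nhds_iff_ball.1
      ((hg.continuous_deriv le_rfl).norm.continuousAt.eventually_lt_const hd)
    filter_upwards [Ioo_mem_nhdsGT (lt_add_of_pos_right x hr)] with y hy
    have hIcc : ∀ z ∈ Icc x y, ‖deriv g z‖ ≤ d := fun z hz => (hball z (by
      rw [Metric.mem_ball, Real.dist_eq, abs_of_nonneg (sub_nonneg.2 hz.1)]
      linarith [hz.2, hy.2])).le
    refine ((div_le_iff₀ (sub_pos.2 hy.1)).2 ?_).trans_lt hdc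
    refine ENNReal.toReal_le_of_le_ofReal (mul_nonneg hd_nonneg (sub_nonneg.2 hy.1.le)) ?_
    rw [ENNReal.ofReal_mul hd_nonneg]
    exact (measure_mono Ioc_subset_Icc_self).trans (comap_hausdorffMeasure_Icc_le hg hinj hIcc)

theorem comap_hausdorffMeasure_eq_withDensity (hg : ContDiff ℝ 1 g) (hinj : Function.Injective g) :
    (Measure.hausdorffMeasure 1).comap g =
      volume.withDensity fun s => ENNReal.ofReal ‖deriv g s‖ := by
  have : IsLocallyFiniteMeasure ((Measure.hausdorffMeasure 1).comap g) :=
    ⟨fun x => ⟨Icc (x - 1) (x + 1), Icc_mem_nhds (sub_one_lt x) (lt_add_one x),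
      comap_hausdorffMeasure_Icc_lt_top hg hinj⟩⟩
  have : NullSingletonClass ((Measure.hausdorffMeasure 1 : Measure E).comap g) := ⟨fun x => by
    rw [(hg.continuous.measurableEmbedding hinj).comap_apply, image_singleton]
    exact (Measure.nullSingletonClass_hausdorff E one_pos).measure_singleton (g x)⟩
  exact eq_withDensity_of_tendsto_measureReal_Ioc_div (hg.continuous_deriv le_rfl).norm
    (fun _ => norm_nonneg _) (tendsto_comap_hausdorffMeasure_Ioc_div hg hinj)

theorem setIntegral_hausdorffMeasure_range (hg : ContDiff ℝ 1 g) (hinj : Function.Injective g)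
    {F : Type*} [NormedAddCommGroup F] [NormedSpace ℝ F] (h : E → F) :
    ∫ y in range g, h y ∂(Measure.hausdorffMeasure 1) = ∫ s, ‖deriv g s‖ • h (g s) := by
  have hm := hg.continuous.measurableEmbedding hinj
  rw [← hm.map_comap, hm.integral_map, comap_hausdorffMeasure_eq_withDensity hg hinj,
    integral_withDensity_eq_integral_toReal_smul
      (hg.continuous_deriv le_rfl).norm.measurable.ennreal_ofReal (by simp)]
  simp only [ENNReal.toReal_ofReal (norm_nonneg _)]

end CurveLength

/-! ### Graph coordinates near a boundary point -/

/-- The point of the graph of `f` above `s`, in the coordinates given by `L`. -/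
def graphPt (L : Plane ≃ₗᵢ[ℝ] Plane) (f : ℝ → ℝ) (s : ℝ) : Plane := L.symm !₂[s, f s]

/-- The upward normal, with vertical component `1`, to the graph of `f`, in the coordinates given
by `L`. -/
def graphNormal (L : Plane ≃ₗᵢ[ℝ] Plane) (f : ℝ → ℝ) (s : ℝ) : Plane := L.symm !₂[-deriv f s, 1]

/-- The vertical depth of a point below the graph of `f`, in the coordinates given by `L`. -/
def depth (L : Plane ≃ₗᵢ[ℝ] Plane) (f : ℝ → ℝ) (x : Plane) : ℝ := f ((L x) 0) - (L x) 1

/-- In the ball of radius `r` about `p`, the set `Ω` is the hypograph of the smooth function `f`. -/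
structure IsGraphChart (Ω : Set Plane) (p : Plane) (L : Plane ≃ₗᵢ[ℝ] Plane) (f : ℝ → ℝ)
    (r : ℝ) : Prop where
  contDiff : ContDiff ℝ ∞ f
  pos : 0 < r
  mem_iff : ∀ x ∈ Metric.ball p r, x ∈ Ω ↔ 0 < depth L f x

theorem HasSmoothBoundary.exists_isGraphChart {Ω : Set Plane} (h : HasSmoothBoundary Ω) {p : Plane}
    (hp : p ∈ frontier Ω) : ∃ L f r, IsGraphChart Ω p L f r := by
  obtain ⟨L, f, hf, r, hr, hm⟩ := h p hp
  exact ⟨L, f, r, hf, hr, fun x hx => by rw [hm x hx, depth, sub_pos]⟩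

section Graph

variable {L : Plane ≃ₗᵢ[ℝ] Plane} {f : ℝ → ℝ} {n : WithTop ℕ∞}

theorem inner_symm_toLp (x : Plane) (a b : ℝ) :
    ⟪x, L.symm !₂[a, b]⟫ = a * (L x) 0 + b * (L x) 1 := by
  have : ⟪x, L.symm !₂[a, b]⟫ = ⟪L x, !₂[a, b]⟫ := by
    rw [← L.inner_map_map, L.apply_symm_apply]
  rw [this]
  simp [PiLp.inner_apply, Fin.sum_univ_two]

theorem norm_graphNormal_sq (s : ℝ) : ‖graphNormal L f s‖ ^ 2 = deriv f s ^ 2 + 1 := by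
  rw [graphNormal, LinearIsometryEquiv.norm_map, EuclideanSpace.norm_sq_eq]
  simp [Fin.sum_univ_two]

theorem one_le_norm_graphNormal (s : ℝ) : 1 ≤ ‖graphNormal L f s‖ := by
  rw [← one_le_sq_iff₀ (norm_nonneg _), norm_graphNormal_sq]
  exact le_add_of_nonneg_left (sq_nonneg _)

theorem norm_graphNormal_pos (s : ℝ) : 0 < ‖graphNormal L f s‖ :=
  zero_lt_one.trans_le (one_le_norm_graphNormal s)

@[simp]
theorem apply_graphPt_zero (s : ℝ) : (L (graphPt L f s)) 0 = s := by simp [graphPt]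

@[simp]
theorem apply_graphPt_one (s : ℝ) : (L (graphPt L f s)) 1 = f s := by simp [graphPt]

@[simp]
theorem depth_graphPt (s : ℝ) : depth L f (graphPt L f s) = 0 := by simp [depth]

theorem graphPt_of_depth_eq_zero {x : Plane} (h : depth L f x = 0) :
    graphPt L f ((L x) 0) = x := by
  rw [graphPt, LinearIsometryEquiv.symm_apply_eq]
  ext i
  fin_cases i
  · simp
  · simpa [depth, sub_eq_zero] using h

theorem injective_graphPt : Function.Injective (graphPt L f) := fun s t h => by
  rw [← apply_graphPt_zero (L := L) (f := f) s, h, apply_graphPt_zero]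

theorem mem_range_graphPt_iff {x : Plane} : x ∈ range (graphPt L f) ↔ depth L f x = 0 :=
  ⟨by rintro ⟨s, rfl⟩; simp, fun h => ⟨_, graphPt_of_depth_eq_zero h⟩⟩

theorem hasDerivAt_toLp_pair {a b : ℝ → ℝ} {a' b' s : ℝ} (ha : HasDerivAt a a' s)
    (hb : HasDerivAt b b' s) : HasDerivAt (fun t => (!₂[a t, b t] : Plane)) !₂[a', b'] s := by
  have h : HasDerivAt (fun t => ![a t, b t]) ![a', b'] s := by
    rw [hasDerivAt_pi]
    intro i
    fin_cases i
    · simpa using ha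
    · simpa using hb
  exact ((PiLp.continuousLinearEquiv 2 ℝ fun _ : Fin 2 => ℝ).symm.toContinuousLinearMap
    |>.hasFDerivAt).comp_hasDerivAt s h

theorem hasDerivAt_graphPt (hf : Differentiable ℝ f) (s : ℝ) :
    HasDerivAt (graphPt L f) (L.symm !₂[1, deriv f s]) s :=
  (L.symm.toContinuousLinearEquiv.toContinuousLinearMap.hasFDerivAt).comp_hasDerivAt s
    (hasDerivAt_toLp_pair (hasDerivAt_id s) (hf s).hasDerivAt)

theorem norm_deriv_graphPt (hf : Differentiable ℝ f) (s : ℝ) :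
    ‖deriv (graphPt L f) s‖ = ‖graphNormal L f s‖ := by
  rw [(hasDerivAt_graphPt hf s).deriv, graphNormal, LinearIsometryEquiv.norm_map,
    LinearIsometryEquiv.norm_map, EuclideanSpace.norm_eq, EuclideanSpace.norm_eq]
  simp [Fin.sum_univ_two, add_comm]

theorem contDiff_toLp_pair {a b : ℝ → ℝ} (ha : ContDiff ℝ n a)
    (hb : ContDiff ℝ n b) : ContDiff ℝ n fun t => (!₂[a t, b t] : Plane) := by
  rw [contDiff_euclidean]
  intro i
  fin_cases i
  · simpa using ha
  · simpa using hb

theorem contDiff_graphPt (hf : ContDiff ℝ n f) : ContDiff ℝ n (graphPt L f) :=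
  L.symm.contDiff.comp (contDiff_toLp_pair contDiff_id hf)

theorem continuous_graphNormal (hf : ContDiff ℝ 1 f) : Continuous (graphNormal L f) :=
  L.symm.continuous.comp (contDiff_toLp_pair (n := 0)
    (contDiff_zero.2 (hf.continuous_deriv le_rfl).neg) contDiff_const).continuous

theorem contDiff_coord (i : Fin 2) : ContDiff ℝ n fun x : Plane => (L x) i :=
  (contDiff_euclidean.1 L.contDiff) i

theorem contDiff_depth (hf : ContDiff ℝ n f) : ContDiff ℝ n (depth L f) :=
  (hf.comp (contDiff_coord 0)).sub (contDiff_coord 1)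

theorem abs_coord_sub_le (i : Fin 2) {x y : Plane} : |(L y) i - (L x) i| ≤ ‖y - x‖ := by
  rw [← PiLp.sub_apply, ← map_sub, ← Real.norm_eq_abs, ← L.norm_map (y - x)]
  exact PiLp.norm_apply_le _ i

theorem hasGradientAt_coord (i : Fin 2) (x : Plane) :
    HasGradientAt (fun x : Plane => (L x) i) (L.symm (EuclideanSpace.single i 1)) x := by
  rw [hasGradientAt_iff_hasFDerivAt]
  have h : HasFDerivAt (fun x : Plane => (L x) i) ((EuclideanSpace.proj (𝕜 := ℝ) i).comp
      L.toContinuousLinearEquiv.toContinuousLinearMap) x :=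
    ((EuclideanSpace.proj (𝕜 := ℝ) i).comp
      L.toContinuousLinearEquiv.toContinuousLinearMap).hasFDerivAt
  refine h.congr_fderiv (ContinuousLinearMap.ext fun v => ?_)
  rw [InnerProductSpace.toDual_apply_apply, ← L.inner_map_map, L.apply_symm_apply]
  simp [EuclideanSpace.inner_single_left]

theorem hasGradientAt_depth (hf : Differentiable ℝ f) (x : Plane) :
    HasGradientAt (depth L f) (-graphNormal L f ((L x) 0)) x := by
  have h0 := hasGradientAt_iff_hasFDerivAt.1 (hasGradientAt_coord (L := L) 0 x)
  have h1 := hasGradientAt_iff_hasFDerivAt.1 (hasGradientAt_coord (L := L) 1 x)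
  have hN : -graphNormal L f ((L x) 0) =
      deriv f ((L x) 0) • L.symm (EuclideanSpace.single 0 1) -
        L.symm (EuclideanSpace.single 1 1) := by
    rw [graphNormal, ← map_smul, ← map_sub, ← map_neg]
    congr 1
    ext i
    fin_cases i <;> simp
  rw [hN, hasGradientAt_iff_hasFDerivAt, map_sub, map_smul]
  exact ((hf ((L x) 0)).hasDerivAt.comp_hasFDerivAt x h0).sub h1

theorem hasDerivAt_depth_ray (hf : Differentiable ℝ f) (x v : Plane) :
    HasDerivAt (fun t : ℝ => depth L f (x + t • v)) (-⟪v, graphNormal L f ((L x) 0)⟫) 0 := by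
  have hray : HasDerivAt (fun t : ℝ => x + t • v) v 0 := by
    simpa using ((hasDerivAt_id (0 : ℝ)).smul_const v).const_add x
  have hdepth := hasGradientAt_iff_hasFDerivAt.1 (hasGradientAt_depth (L := L) hf x)
  have hx : x = x + (0 : ℝ) • v := by rw [zero_smul, add_zero]
  have h := HasFDerivAt.comp_hasDerivAt (0 : ℝ) (hx ▸ hdepth) hray
  rwa [← hx, InnerProductSpace.toDual_apply_apply, inner_neg_left, real_inner_comm] at h

end Graph

theorem norm_sub_sub_smul_deriv_le {F : Type*} [NormedAddCommGroup F] [NormedSpace ℝ F] {f : ℝ → F}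
    (hf : Differentiable ℝ f) {K : NNReal} {a b : ℝ} (hK : LipschitzOnWith K (deriv f) (uIcc a b)) :
    ‖f b - f a - (b - a) • deriv f b‖ ≤ K * |b - a| ^ 2 := by
  have hderiv : ∀ z ∈ uIcc a b, HasDerivWithinAt (fun z => f z - z • deriv f b)
      (deriv f z - deriv f b) (uIcc a b) z := fun z _ => by
    have h := (hf z).hasDerivAt.sub ((hasDerivAt_id z).smul_const (deriv f b))
    rw [one_smul] at h
    exact h.hasDerivWithinAt
  have hbound : ∀ z ∈ uIcc a b, ‖deriv f z - deriv f b‖ ≤ K * |b - a| := fun z hz => by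
    rw [← dist_eq_norm]
    refine (hK.dist_le_mul z hz b right_mem_uIcc).trans (mul_le_mul_of_nonneg_left ?_ K.2)
    rw [Real.dist_eq, abs_sub_comm]
    exact abs_sub_right_of_mem_uIcc hz
  have h := (convex_uIcc a b).norm_image_sub_le_of_norm_hasDerivWithin_le hderiv hbound
    left_mem_uIcc right_mem_uIcc
  rw [Real.norm_eq_abs, mul_assoc, ← pow_two] at h
  rwa [sub_smul, show f b - f a - (b • deriv f b - a • deriv f b) =
    f b - b • deriv f b - (f a - a • deriv f b) by abel]

theorem eventually_pos_of_hasDerivAt {h : ℝ → ℝ} {h' a : ℝ} (hd : HasDerivAt h h' a) (ha : h a = 0)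
    (hpos : 0 < h') : ∀ᶠ t in 𝓝[>] a, 0 < h t := by
  have hs : Tendsto (slope h a) (𝓝[>] a) (𝓝 h') :=
    (hasDerivWithinAt_iff_tendsto_slope' self_notMem_Ioi).1 hd.hasDerivWithinAt
  filter_upwards [hs.eventually_const_lt hpos, self_mem_nhdsWithin] with t ht hat
  rw [slope_def_field, ha, sub_zero] at ht
  exact (div_pos_iff_of_pos_right (sub_pos.2 hat)).1 ht

theorem IsOutwardUnitNormal.unique {Ω : Set Plane} {p n n' : Plane}
    (h : IsOutwardUnitNormal Ω p n) (h' : IsOutwardUnitNormal Ω p n') : n = n' := by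
  by_contra hne
  have h1 : ⟪n, n'⟫ < 1 := (inner_lt_one_iff_real_of_norm_eq_one h.1 h'.1).2 hne
  have a : ⟪n' - n, n⟫ < 0 := by
    rw [inner_sub_left, real_inner_self_eq_norm_sq, h.1, real_inner_comm]
    linarith
  have b : 0 < ⟪n' - n, n'⟫ := by
    rw [inner_sub_left, real_inner_self_eq_norm_sq, h'.1]
    linarith
  obtain ⟨t, ht1, ht2⟩ := ((h.2.1 _ a).and (h'.2.2 _ b)).exists
  exact ht2 (subset_closure ht1)

namespace IsGraphChart

variable {Ω : Set Plane} {p : Plane} {L : Plane ≃ₗᵢ[ℝ] Plane} {f : ℝ → ℝ} {r : ℝ}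

theorem contDiff_one (h : IsGraphChart Ω p L f r) : ContDiff ℝ 1 f :=
  h.contDiff.of_le (by simp)

theorem differentiable (h : IsGraphChart Ω p L f r) : Differentiable ℝ f :=
  h.contDiff_one.differentiable one_ne_zero

theorem notMem_closure (h : IsGraphChart Ω p L f r) {x : Plane} (hx : x ∈ Metric.ball p r)
    (hd : depth L f x < 0) : x ∉ closure Ω := by
  rw [mem_closure_iff_nhds]
  push Not
  refine ⟨Metric.ball p r ∩ {y | depth L f y < 0}, ?_, ?_⟩
  · exact inter_mem (Metric.isOpen_ball.mem_nhds hx)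
      ((contDiff_depth h.contDiff_one).continuous.continuousAt.eventually (gt_mem_nhds hd))
  · rw [eq_empty_iff_forall_notMem]
    rintro y ⟨⟨hy, hy'⟩, hyΩ⟩
    exact absurd ((h.mem_iff y hy).1 hyΩ) (not_lt.2 (le_of_lt hy'))

theorem eventually_mem_ball {x v : Plane} (hx : x ∈ Metric.ball p r) :
    ∀ᶠ t in 𝓝[>] (0 : ℝ), x + t • v ∈ Metric.ball p r := by
  have hc : Continuous fun t : ℝ => x + t • v := by fun_prop
  exact (hc.continuousAt.eventually (Metric.isOpen_ball.mem_nhds (by simpa using hx))).filter_mono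
    nhdsWithin_le_nhds

theorem isOutwardUnitNormal (h : IsGraphChart Ω p L f r) {x : Plane} (hx : x ∈ Metric.ball p r)
    (hd : depth L f x = 0) : IsOutwardUnitNormal Ω x
      (‖graphNormal L f ((L x) 0)‖⁻¹ • graphNormal L f ((L x) 0)) := by
  have hN := norm_graphNormal_pos (L := L) (f := f) ((L x) 0)
  refine ⟨by rw [norm_smul, norm_inv, norm_norm, inv_mul_cancel₀ hN.ne'], fun v hv => ?_,
    fun v hv => ?_⟩
  · rw [real_inner_smul_right] at hv
    have hv' : 0 < -⟪v, graphNormal L f ((L x) 0)⟫ := by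
      have := (mul_neg_iff.1 hv).resolve_right fun h' => absurd h'.1 (not_lt.2 (by positivity))
      linarith [this.2]
    filter_upwards [eventually_pos_of_hasDerivAt (hasDerivAt_depth_ray h.differentiable x v)
      (by simpa using hd) hv', eventually_mem_ball (v := v) hx] with t ht ht'
    exact (h.mem_iff _ ht').2 ht
  · rw [real_inner_smul_right] at hv
    have hv' : 0 < - -⟪v, graphNormal L f ((L x) 0)⟫ := by
      rw [neg_neg]
      exact (pos_iff_pos_of_mul_pos hv).1 (by positivity)
    filter_upwards [eventually_pos_of_hasDerivAt (hasDerivAt_depth_ray h.differentiable x v).neg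
      (by simpa using hd) hv', eventually_mem_ball (v := v) hx] with t ht ht'
    exact h.notMem_closure ht' (by simpa using ht)

theorem outwardNormal_eq (h : IsGraphChart Ω p L f r) {x : Plane} (hx : x ∈ Metric.ball p r)
    (hd : depth L f x = 0) : outwardNormal Ω x =
      ‖graphNormal L f ((L x) 0)‖⁻¹ • graphNormal L f ((L x) 0) :=
  (Classical.epsilon_spec ⟨_, h.isOutwardUnitNormal hx hd⟩).unique (h.isOutwardUnitNormal hx hd)

theorem mem_frontier_iff (h : IsGraphChart Ω p L f r) (hΩ : IsOpen Ω) {x : Plane}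
    (hx : x ∈ Metric.ball p r) : x ∈ frontier Ω ↔ depth L f x = 0 := by
  rw [frontier, hΩ.interior_eq]
  constructor
  · rintro ⟨h1, h2⟩
    rw [h.mem_iff x hx, not_lt] at h2
    by_contra hne
    exact h.notMem_closure hx (lt_of_le_of_ne h2 hne) h1
  · intro hd
    refine ⟨?_, fun hxΩ => absurd ((h.mem_iff x hx).1 hxΩ) hd.not_gt⟩
    have hn := h.isOutwardUnitNormal hx hd
    set n := ‖graphNormal L f ((L x) 0)‖⁻¹ • graphNormal L f ((L x) 0)
    have h1 := hn.2.1 (-n) (by rw [inner_neg_left, real_inner_self_eq_norm_sq, hn.1]; norm_num)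
    have hc : Tendsto (fun t : ℝ => x + t • (-n)) (𝓝[>] 0) (𝓝 x) := by
      have : Continuous fun t : ℝ => x + t • (-n) := by fun_prop
      simpa using (this.tendsto 0).mono_left nhdsWithin_le_nhds
    exact mem_closure_of_tendsto hc h1
theorem setIntegral_boundaryMeasure (h : IsGraphChart Ω p L f r) (hΩ : IsOpen Ω) {F : Type*}
    [NormedAddCommGroup F] [NormedSpace ℝ F] {k : Plane → F}
    (hk : ∀ x ∉ Metric.ball p r, k x = 0) :
    ∫ y, k y ∂(boundaryMeasure Ω) = ∫ s, ‖graphNormal L f s‖ • k (graphPt L f s) := by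
  have hc := contDiff_graphPt (L := L) h.contDiff_one
  have hindicator : (frontier Ω).indicator k = (range (graphPt L f)).indicator k := by
    funext x
    by_cases hx : x ∈ Metric.ball p r
    · simp only [indicator, h.mem_frontier_iff hΩ hx, mem_range_graphPt_iff]
    · simp only [indicator, hk x hx, ite_self]
  rw [boundaryMeasure, ← integral_indicator isClosed_frontier.measurableSet, hindicator,
    integral_indicator (hc.continuous.measurableEmbedding injective_graphPt).measurableSet_range,
    setIntegral_hausdorffMeasure_range hc injective_graphPt]
  simp only [norm_deriv_graphPt h.differentiable]

theorem hausdorffMeasure_frontier_inter_ball_lt_top (h : IsGraphChart Ω p L f r) (hΩ : IsOpen Ω) :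
    Measure.hausdorffMeasure 1 (frontier Ω ∩ Metric.ball p r) < ⊤ := by
  have hc := contDiff_graphPt (L := L) h.contDiff_one
  have hsub : frontier Ω ∩ Metric.ball p r ⊆
      graphPt L f '' Icc ((L p) 0 - r) ((L p) 0 + r) := by
    rintro x ⟨hx, hxb⟩
    refine ⟨(L x) 0, ?_, graphPt_of_depth_eq_zero ((h.mem_frontier_iff hΩ hxb).1 hx)⟩
    have hr := abs_le.1 ((abs_coord_sub_le (L := L) 0).trans
      (mem_ball_iff_norm.1 hxb).le)
    exact ⟨by linarith [hr.1], by linarith [hr.2]⟩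
  refine (measure_mono hsub).trans_lt ?_
  rw [← (hc.continuous.measurableEmbedding injective_graphPt).comap_apply]
  exact comap_hausdorffMeasure_Icc_lt_top hc injective_graphPt

theorem inner_sub_graphNormal {x y : Plane} (hx : depth L f x = 0) (hy : depth L f y = 0) (s : ℝ) :
    ⟪y - x, graphNormal L f s⟫ =
      f ((L y) 0) - f ((L x) 0) - ((L y) 0 - (L x) 0) * deriv f s := by
  rw [depth, sub_eq_zero] at hx hy
  rw [graphNormal, inner_symm_toLp, map_sub, PiLp.sub_apply, PiLp.sub_apply, ← hx, ← hy]
  ring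

theorem exists_abs_inner_outwardNormal_le (h : IsGraphChart Ω p L f r) (hΩ : IsOpen Ω)
    (hp : p ∈ frontier Ω) :
    ∃ C δ : ℝ, 0 < δ ∧ ∀ y ∈ frontier Ω ∩ Metric.ball p δ,
      |⟪y - p, outwardNormal Ω y⟫| ≤ C * ‖y - p‖ ^ 2 := by
  have hf' : ContDiff ℝ 1 (deriv f) := ContDiff.deriv' (contDiff_infty.1 h.contDiff 2)
  obtain ⟨K, t, ht, hK⟩ := (hf'.contDiffAt (x := (L p) 0)).exists_lipschitzOnWith
  obtain ⟨η, hη, hηt⟩ := Metric.mem_nhds_iff.1 ht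
  refine ⟨K, min r η, lt_min h.pos hη, fun y ⟨hy, hyb⟩ => ?_⟩
  have hyr : y ∈ Metric.ball p r := Metric.ball_subset_ball (min_le_left _ _) hyb
  have hyd : depth L f y = 0 := (h.mem_frontier_iff hΩ hyr).1 hy
  have hpd : depth L f p = 0 := (h.mem_frontier_iff hΩ (Metric.mem_ball_self h.pos)).1 hp
  have hcoord : |(L y) 0 - (L p) 0| ≤ ‖y - p‖ := abs_coord_sub_le 0
  have hseg : uIcc ((L p) 0) ((L y) 0) ⊆ t := fun z hz => hηt <| by
    rw [Metric.mem_ball, Real.dist_eq]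
    exact (abs_sub_left_of_mem_uIcc hz).trans_lt
      (hcoord.trans_lt ((mem_ball_iff_norm.1 hyb).trans_le (min_le_right _ _)))
  rw [h.outwardNormal_eq hyr hyd, real_inner_smul_right, abs_mul, abs_inv, abs_norm,
    inner_sub_graphNormal hpd hyd]
  calc ‖graphNormal L f ((L y) 0)‖⁻¹ *
        |f ((L y) 0) - f ((L p) 0) - ((L y) 0 - (L p) 0) * deriv f ((L y) 0)|
      ≤ |f ((L y) 0) - f ((L p) 0) - ((L y) 0 - (L p) 0) * deriv f ((L y) 0)| :=
        mul_le_of_le_one_left (abs_nonneg _) (inv_le_one_of_one_le₀ (one_le_norm_graphNormal _))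
    _ ≤ K * |(L y) 0 - (L p) 0| ^ 2 :=
        norm_sub_sub_smul_deriv_le h.differentiable (hK.mono hseg)
    _ ≤ K * ‖y - p‖ ^ 2 := by gcongr

end IsGraphChart

/-! ### The boundary of a smooth bounded open set -/

namespace HasSmoothBoundary

variable {Ω : Set Plane}

theorem isFiniteMeasure_boundaryMeasure (hs : HasSmoothBoundary Ω) (hΩ : IsOpen Ω)
    (hb : Bornology.IsBounded Ω) : IsFiniteMeasure (boundaryMeasure Ω) := by
  refine ⟨?_⟩
  rw [boundaryMeasure, Measure.restrict_apply_univ]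
  refine (isCompact_frontier_of_isBounded hb).measure_lt_top_of_nhdsWithin fun p hp => ?_
  obtain ⟨L, f, r, h⟩ := hs.exists_isGraphChart hp
  exact ⟨_, inter_mem_nhdsWithin _ (Metric.ball_mem_nhds p h.pos),
    h.hausdorffMeasure_frontier_inter_ball_lt_top hΩ⟩

theorem isOutwardUnitNormal (hs : HasSmoothBoundary Ω) (hΩ : IsOpen Ω) {p : Plane}
    (hp : p ∈ frontier Ω) : IsOutwardUnitNormal Ω p (outwardNormal Ω p) := by
  obtain ⟨L, f, r, h⟩ := hs.exists_isGraphChart hp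
  have hpr := Metric.mem_ball_self (x := p) h.pos
  exact Classical.epsilon_spec ⟨_, h.isOutwardUnitNormal hpr ((h.mem_frontier_iff hΩ hpr).1 hp)⟩

theorem continuousOn_outwardNormal (hs : HasSmoothBoundary Ω) (hΩ : IsOpen Ω) :
    ContinuousOn (outwardNormal Ω) (frontier Ω) := by
  intro p hp
  obtain ⟨L, f, r, h⟩ := hs.exists_isGraphChart hp
  have hN : Continuous fun x : Plane => graphNormal L f ((L x) 0) :=
    (continuous_graphNormal h.contDiff_one).comp (contDiff_coord (n := 0) 0).continuous
  have heq : ∀ x ∈ Metric.ball p r, x ∈ frontier Ω →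
      outwardNormal Ω x = ‖graphNormal L f ((L x) 0)‖⁻¹ • graphNormal L f ((L x) 0) :=
    fun x hx hxΩ => h.outwardNormal_eq hx ((h.mem_frontier_iff hΩ hx).1 hxΩ)
  refine ((hN.norm.inv₀ fun x => (norm_graphNormal_pos _).ne').smul
    hN).continuousWithinAt.congr_of_eventuallyEq ?_ (heq p (Metric.mem_ball_self h.pos) hp)
  filter_upwards [mem_nhdsWithin_of_mem_nhds (Metric.ball_mem_nhds p h.pos),
    self_mem_nhdsWithin] with x hx hxΩ
  exact heq x hx hxΩ

theorem exists_abs_inner_outwardNormal_le (hs : HasSmoothBoundary Ω) (hΩ : IsOpen Ω) {p : Plane}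
    (hp : p ∈ frontier Ω) :
    ∃ C : ℝ, ∀ y ∈ frontier Ω, |⟪y - p, outwardNormal Ω y⟫| ≤ C * ‖y - p‖ ^ 2 := by
  obtain ⟨L, f, r, h⟩ := hs.exists_isGraphChart hp
  obtain ⟨C, δ, hδ, hC⟩ := h.exists_abs_inner_outwardNormal_le hΩ hp
  refine ⟨max C δ⁻¹, fun y hy => ?_⟩
  by_cases hyb : y ∈ Metric.ball p δ
  · exact (hC y ⟨hy, hyb⟩).trans (mul_le_mul_of_nonneg_right (le_max_left _ _) (by positivity))
  · have hd : δ ≤ ‖y - p‖ := by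
      rwa [Metric.mem_ball, dist_eq_norm, not_lt] at hyb
    calc |⟪y - p, outwardNormal Ω y⟫| ≤ ‖y - p‖ * ‖outwardNormal Ω y‖ :=
          abs_real_inner_le_norm _ _
      _ = δ⁻¹ * (δ * ‖y - p‖) := by
          rw [(hs.isOutwardUnitNormal hΩ hy).1, mul_one, inv_mul_cancel_left₀ hδ.ne']
      _ ≤ δ⁻¹ * (‖y - p‖ * ‖y - p‖) := by gcongr
      _ ≤ max C δ⁻¹ * ‖y - p‖ ^ 2 := by
          rw [← pow_two]
          exact mul_le_mul_of_nonneg_right (le_max_right _ _) (by positivity)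

end HasSmoothBoundary

/-! ### Concentration on the boundary -/

theorem map_prodMap_id_mul_left {δ : ℝ} (hδ : δ ≠ 0) :
    (volume : Measure (ℝ × ℝ)).map (Prod.map id (δ * ·)) = ENNReal.ofReal |δ⁻¹| • volume := by
  rw [Measure.volume_eq_prod, ← Measure.map_prod_map _ _ measurable_id (measurable_const_mul δ),
    Measure.map_id, Real.map_volume_mul_left hδ, Measure.prod_smul_right]

section ConcentratingSlab

variable {F : Type*} [NormedAddCommGroup F] [NormedSpace ℝ F] {ρ : ℝ → ℝ} {g : ℝ × ℝ → F}
  {g₀ : ℝ → F} {I : Set ℝ} {C : ℝ}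

theorem integral_inv_mul_comp_div_smul {δ : ℝ} (hδ : 0 < δ) (ρ : ℝ → ℝ) (g : ℝ × ℝ → F) :
    ∫ q : ℝ × ℝ, (δ⁻¹ * ρ (q.2 / δ)) • g q = ∫ q : ℝ × ℝ, ρ q.2 • g (q.1, δ * q.2) := by
  have hemb : MeasurableEmbedding (Prod.map id (δ * ·) : ℝ × ℝ → ℝ × ℝ) :=
    ((Homeomorph.refl ℝ).prodCongr (Homeomorph.mulLeft₀ δ hδ.ne')).measurableEmbedding
  have h := hemb.integral_map (μ := volume) fun q => ρ (q.2 / δ) • g q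
  rw [map_prodMap_id_mul_left hδ.ne', integral_smul_measure, ENNReal.toReal_ofReal (abs_nonneg _),
    abs_of_pos (inv_pos.2 hδ), ← integral_smul] at h
  simpa only [smul_smul, Prod.map, id_eq, mul_div_cancel_left₀ _ hδ.ne'] using h

theorem quasiMeasurePreserving_prodMap_id_mul_left {δ : ℝ} (hδ : δ ≠ 0) :
    Measure.QuasiMeasurePreserving (Prod.map id (δ * ·) : ℝ × ℝ → ℝ × ℝ) :=
  ⟨measurable_id.prodMap (measurable_const_mul δ), by
    rw [map_prodMap_id_mul_left hδ]
    exact Measure.smul_absolutelyContinuous⟩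

theorem norm_smul_le_indicator {R : ℝ} (hR : ∀ t, ‖ρ t‖ ≤ R) (hgC : ∀ q, ‖g q‖ ≤ C)
    (hgI : ∀ q, q.1 ∉ I → g q = 0) (δ : ℝ) (q : ℝ × ℝ) :
    ‖ρ q.2 • g (q.1, δ * q.2)‖ ≤ (I ×ˢ tsupport ρ).indicator (fun _ => R * C) q := by
  by_cases hq : q ∈ I ×ˢ tsupport ρ
  · rw [indicator_of_mem hq, norm_smul]
    exact mul_le_mul (hR _) (hgC _) (norm_nonneg _) ((norm_nonneg _).trans (hR 0))
  · rw [indicator_of_notMem hq, norm_le_zero_iff, smul_eq_zero]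
    rcases not_and_or.1 hq with hq | hq
    · exact Or.inr (hgI _ hq)
    · exact Or.inl (image_eq_zero_of_notMem_tsupport hq)

theorem tendsto_smul_comp_mul (hρ_pos : tsupport ρ ⊆ Ioi 0)
    (hg₀ : ∀ s, Tendsto (fun t => g (s, t)) (𝓝[>] 0) (𝓝 (g₀ s))) (q : ℝ × ℝ) :
    Tendsto (fun δ : ℝ => ρ q.2 • g (q.1, δ * q.2)) (𝓝[>] 0) (𝓝 (ρ q.2 • g₀ q.1)) := by
  by_cases hq : q.2 ∈ tsupport ρ
  · refine ((hg₀ q.1).comp (tendsto_nhdsWithin_iff.2 ⟨?_, ?_⟩)).const_smul (ρ q.2)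
    · simpa only [zero_mul] using ((continuous_mul_const q.2).tendsto 0).mono_left
        nhdsWithin_le_nhds
    · filter_upwards [self_mem_nhdsWithin] with δ hδ
      exact mul_pos (mem_Ioi.1 hδ) (mem_Ioi.1 (hρ_pos hq))
  · simp only [image_eq_zero_of_notMem_tsupport hq, zero_smul, tendsto_const_nhds]

theorem tendsto_integral_inv_mul_comp_div_smul (hρ : Continuous ρ) (hρc : HasCompactSupport ρ)
    (hρ_pos : tsupport ρ ⊆ Ioi 0) (hI : IsCompact I) (hg : AEStronglyMeasurable g)
    (hgC : ∀ q, ‖g q‖ ≤ C) (hgI : ∀ q, q.1 ∉ I → g q = 0)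
    (hg₀ : ∀ s, Tendsto (fun t => g (s, t)) (𝓝[>] 0) (𝓝 (g₀ s))) :
    Tendsto (fun δ : ℝ => ∫ q : ℝ × ℝ, (δ⁻¹ * ρ (q.2 / δ)) • g q) (𝓝[>] 0)
      (𝓝 ((∫ t, ρ t) • ∫ s, g₀ s)) := by
  obtain ⟨R, hR⟩ := hρ.bounded_above_of_compact_support hρc
  have hlim : Tendsto (fun δ : ℝ => ∫ q : ℝ × ℝ, ρ q.2 • g (q.1, δ * q.2)) (𝓝[>] 0)
      (𝓝 (∫ q : ℝ × ℝ, ρ q.2 • g₀ q.1)) := by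
    refine tendsto_integral_filter_of_dominated_convergence
      ((I ×ˢ tsupport ρ).indicator fun _ => R * C) ?_
      (Eventually.of_forall fun δ => Eventually.of_forall (norm_smul_le_indicator hR hgC hgI δ)) ?_
      (Eventually.of_forall (tendsto_smul_comp_mul hρ_pos hg₀))
    · filter_upwards [self_mem_nhdsWithin] with δ hδ
      exact (hρ.comp continuous_snd).aestronglyMeasurable.smul
        (hg.comp_quasiMeasurePreserving (quasiMeasurePreserving_prodMap_id_mul_left (ne_of_gt hδ)))
    · rw [integrable_indicator_iff (hI.measurableSet.prod (isClosed_tsupport ρ).measurableSet)]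
      exact integrableOn_const (hI.prod hρc).measure_lt_top.ne
  have hprod : ∫ q : ℝ × ℝ, ρ q.2 • g₀ q.1 = (∫ t, ρ t) • ∫ s, g₀ s := by
    rw [← integral_prod_smul, ← integral_prod_swap]
    rfl
  rw [← hprod]
  refine hlim.congr' ?_
  filter_upwards [self_mem_nhdsWithin] with δ hδ
  exact (integral_inv_mul_comp_div_smul hδ ρ g).symm

end ConcentratingSlab

section GraphCoords

variable {L : Plane ≃ₗᵢ[ℝ] Plane} {f : ℝ → ℝ}

/-- The point at depth `q.2` below the point of the graph of `f` above `q.1`, in the coordinates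
given by `L`. -/
def graphCoords (L : Plane ≃ₗᵢ[ℝ] Plane) (f : ℝ → ℝ) (q : ℝ × ℝ) : Plane :=
  L.symm !₂[q.1, f q.1 - q.2]

@[simp]
theorem apply_graphCoords_zero (q : ℝ × ℝ) : (L (graphCoords L f q)) 0 = q.1 := by
  simp [graphCoords]

@[simp]
theorem depth_graphCoords (q : ℝ × ℝ) : depth L f (graphCoords L f q) = q.2 := by
  simp [graphCoords, depth]

theorem graphCoords_zero (s : ℝ) : graphCoords L f (s, 0) = graphPt L f s := by
  simp only [graphCoords, graphPt, sub_zero]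

theorem graphCoords_apply_depth (x : Plane) : graphCoords L f ((L x) 0, depth L f x) = x := by
  rw [graphCoords, LinearIsometryEquiv.symm_apply_eq]
  ext i
  fin_cases i <;> simp [depth]

theorem continuous_graphCoords (hf : Continuous f) : Continuous (graphCoords L f) := by
  refine L.symm.continuous.comp ((PiLp.continuous_toLp 2 _).comp (continuous_pi fun i => ?_))
  fin_cases i
  · exact continuous_fst
  · exact (hf.comp continuous_fst).sub continuous_snd

theorem measurableEmbedding_graphCoords (hf : Continuous f) :
    MeasurableEmbedding (graphCoords L f) := by
  have hinv : Continuous fun x : Plane => ((L x) 0, depth L f x) :=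
    (contDiff_coord (n := 0) 0).continuous.prodMk
      (contDiff_depth (contDiff_zero.2 hf)).continuous
  exact MeasurableEquiv.measurableEmbedding
    { toFun := graphCoords L f
      invFun := fun x => ((L x) 0, depth L f x)
      left_inv := fun q => by simp
      right_inv := graphCoords_apply_depth
      measurable_toFun := (continuous_graphCoords hf).measurable
      measurable_invFun := hinv.measurable }

theorem measurePreserving_graphCoords (hf : Measurable f) :
    MeasurePreserving (graphCoords L f) := by
  have hshear : MeasurePreserving fun q : ℝ × ℝ => (q.1, f q.1 - q.2) :=
    (MeasurePreserving.id volume).skew_product (g := fun s t => f s - t)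
      ((hf.comp measurable_fst).sub measurable_snd)
      (Eventually.of_forall fun s => (volume.measurePreserving_sub_left (f s)).map_eq)
  exact L.symm.measurePreserving.comp
    ((EuclideanSpace.volume_preserving_symm_measurableEquiv_toLp (Fin 2)).symm.comp
      ((measurePreserving_finTwoArrow volume).symm.comp hshear))

end GraphCoords

namespace IsGraphChart

variable {Ω : Set Plane} {p : Plane} {L : Plane ≃ₗᵢ[ℝ] Plane} {f : ℝ → ℝ} {r : ℝ}
  {F : Type*} [NormedAddCommGroup F] {k : Plane → F}

theorem tendsto_indicator_graphCoords (h : IsGraphChart Ω p L f r) (hΩ : IsOpen Ω)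
    (hk : ContinuousOn k (Metric.ball p r ∩ closure Ω)) (hs : tsupport k ⊆ Metric.ball p r)
    (s : ℝ) :
    Tendsto (fun t => Ω.indicator k (graphCoords L f (s, t))) (𝓝[>] 0)
      (𝓝 (k (graphPt L f s))) := by
  have hpath : Tendsto (fun t => graphCoords L f (s, t)) (𝓝[>] 0) (𝓝 (graphPt L f s)) := by
    have hc : Continuous fun t => graphCoords L f (s, t) :=
      (continuous_graphCoords h.contDiff.continuous).comp (Continuous.prodMk_right s)
    simpa only [graphCoords_zero] using (hc.tendsto 0).mono_left nhdsWithin_le_nhds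
  by_cases hb : graphPt L f s ∈ Metric.ball p r
  · have hmem : ∀ᶠ t in 𝓝[>] 0, graphCoords L f (s, t) ∈ Metric.ball p r ∩ Ω := by
      filter_upwards [hpath (Metric.isOpen_ball.mem_nhds hb), self_mem_nhdsWithin] with t hball ht
      exact ⟨hball, (h.mem_iff _ hball).2 (by rwa [depth_graphCoords])⟩
    have hcl : graphPt L f s ∈ closure Ω :=
      frontier_subset_closure ((h.mem_frontier_iff hΩ hb).2 (depth_graphPt s))
    refine ((hk _ ⟨hb, hcl⟩).tendsto.comp (tendsto_nhdsWithin_iff.2 ⟨hpath,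
      hmem.mono fun t ht => ⟨ht.1, subset_closure ht.2⟩⟩)).congr' ?_
    filter_upwards [hmem] with t ht
    rw [Function.comp_apply, indicator_of_mem ht.2]
  · have hk0 : k =ᶠ[𝓝 (graphPt L f s)] 0 :=
      notMem_tsupport_iff_eventuallyEq.1 fun h' => hb (hs h')
    rw [hk0.eq_of_nhds, Pi.zero_apply]
    refine tendsto_const_nhds.congr' ?_
    filter_upwards [hpath.eventually hk0] with t ht
    rw [indicator_apply_eq_zero.2 fun _ => ht]

theorem tendsto_integral_slab [NormedSpace ℝ F] (h : IsGraphChart Ω p L f r) (hΩ : IsOpen Ω)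
    (hk : ContinuousOn k (Metric.ball p r ∩ closure Ω)) (hc : HasCompactSupport k)
    (hs : tsupport k ⊆ Metric.ball p r) {ρ : ℝ → ℝ} (hρ : Continuous ρ) (hρc : HasCompactSupport ρ)
    (hρ_pos : tsupport ρ ⊆ Ioi 0) :
    Tendsto (fun δ : ℝ => ∫ x in Ω, (δ⁻¹ * ρ (depth L f x / δ)) • k x) (𝓝[>] 0)
      (𝓝 ((∫ t, ρ t) • ∫ s, k (graphPt L f s))) := by
  have hf := h.contDiff.continuous
  have hmp := measurePreserving_graphCoords (L := L) hf.measurable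
  obtain ⟨C, hC⟩ := (hc.inter_right isClosed_closure).exists_bound_of_continuousOn
    (hk.mono (inter_subset_inter_left _ hs))
  have hbound : ∀ x, ‖Ω.indicator k x‖ ≤ max C 0 := fun x => by
    by_cases hx : x ∈ Ω ∩ tsupport k
    · rw [indicator_of_mem hx.1]
      exact (hC x ⟨hx.2, subset_closure hx.1⟩).trans (le_max_left _ _)
    · rw [indicator_apply_eq_zero.2 fun hxΩ =>
        image_eq_zero_of_notMem_tsupport fun hxs => hx ⟨hxΩ, hxs⟩, norm_zero]
      exact le_max_right _ _
  have hmeas : AEStronglyMeasurable (Ω.indicator k) := by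
    have hsupp : Ω.indicator k = (Metric.ball p r ∩ Ω).indicator k := by
      rw [inter_comm, ← indicator_indicator, indicator_eq_self.2 ((subset_tsupport k).trans hs)]
    rw [hsupp, aestronglyMeasurable_indicator_iff (Metric.isOpen_ball.inter hΩ).measurableSet]
    exact (hk.mono (inter_subset_inter_right _ subset_closure)).aestronglyMeasurable
      (Metric.isOpen_ball.inter hΩ).measurableSet
  have hproj : IsCompact ((fun x => (L x) 0) '' tsupport k) :=
    hc.isCompact.image (contDiff_coord (n := 0) 0).continuous
  refine (tendsto_integral_inv_mul_comp_div_smul hρ hρc hρ_pos hproj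
    (hmeas.comp_measurePreserving hmp) (fun q => hbound _) (fun q hq => ?_)
    fun s => h.tendsto_indicator_graphCoords hΩ hk hs s).congr fun δ => ?_
  · refine indicator_apply_eq_zero.2 fun _ => image_eq_zero_of_notMem_tsupport fun hmem => ?_
    exact hq ⟨_, hmem, apply_graphCoords_zero q⟩
  · rw [← integral_indicator hΩ.measurableSet,
      ← hmp.integral_comp (measurableEmbedding_graphCoords hf)]
    refine integral_congr_ae (Eventually.of_forall fun q => ?_)
    simp only [Function.comp_apply, indicator_smul_apply, depth_graphCoords]

end IsGraphChart

/-! ### Green's formula up to the boundary -/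

/-- A smooth transition from `0` on `(-∞, 1]` to `1` on `[2, ∞)`, used to cut off test functions
near the boundary. -/
def ramp (t : ℝ) : ℝ := Real.smoothTransition (t - 1)

theorem contDiff_ramp : ContDiff ℝ ∞ ramp :=
  Real.smoothTransition.contDiff.comp (contDiff_id.sub contDiff_const)

theorem ramp_of_le_one {t : ℝ} (h : t ≤ 1) : ramp t = 0 :=
  Real.smoothTransition.zero_of_nonpos (by linarith)

theorem ramp_of_two_le {t : ℝ} (h : 2 ≤ t) : ramp t = 1 :=
  Real.smoothTransition.one_of_one_le (by linarith)

theorem norm_ramp_le_one (t : ℝ) : ‖ramp t‖ ≤ 1 := by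
  rw [ramp, Real.norm_of_nonneg (Real.smoothTransition.nonneg _)]
  exact Real.smoothTransition.le_one _

theorem continuous_deriv_ramp : Continuous (deriv ramp) :=
  contDiff_ramp.continuous_deriv (by simp)

theorem tsupport_deriv_ramp_subset : tsupport (deriv ramp) ⊆ Icc 1 2 := by
  refine closure_minimal (fun t ht => ?_) isClosed_Icc
  by_contra h
  rw [mem_Icc, not_and_or, not_le, not_le] at h
  refine ht ?_
  rcases h with h | h
  · have h0 : ramp =ᶠ[𝓝 t] fun _ => 0 := (gt_mem_nhds h).mono fun _ hs => ramp_of_le_one hs.le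
    rw [h0.deriv_eq, deriv_const]
  · have h1 : ramp =ᶠ[𝓝 t] fun _ => 1 := (lt_mem_nhds h).mono fun _ hs => ramp_of_two_le hs.le
    rw [h1.deriv_eq, deriv_const]

theorem hasCompactSupport_deriv_ramp : HasCompactSupport (deriv ramp) :=
  isCompact_Icc.of_isClosed_subset (isClosed_tsupport _) tsupport_deriv_ramp_subset

theorem integral_deriv_ramp : ∫ t, deriv ramp t = 1 := by
  rw [← setIntegral_eq_integral_of_tsupport_subset tsupport_deriv_ramp_subset fun _ h => h,
    integral_Icc_eq_integral_Ioc, ← intervalIntegral.integral_of_le one_le_two,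
    intervalIntegral.integral_deriv_eq_sub (fun x _ => contDiff_ramp.differentiable (by simp) x)
      (continuous_deriv_ramp.intervalIntegrable _ _), ramp_of_two_le le_rfl, ramp_of_le_one le_rfl,
    sub_zero]

theorem tendsto_ramp_div {t : ℝ} (ht : 0 < t) :
    Tendsto (fun δ => ramp (t / δ)) (𝓝[>] 0) (𝓝 1) := by
  refine tendsto_const_nhds.congr' ?_
  filter_upwards [Ioo_mem_nhdsGT (half_pos ht)] with δ hδ
  rw [ramp_of_two_le]
  rw [le_div_iff₀ hδ.1]
  linarith [hδ.2]

theorem hasDerivAt_ramp_div (t δ : ℝ) :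
    HasDerivAt (fun s => ramp (s / δ)) (δ⁻¹ * deriv ramp (t / δ)) t := by
  have h := HasDerivAt.comp t (contDiff_ramp.differentiable (by simp) (t / δ)).hasDerivAt
    ((hasDerivAt_id t).div_const δ)
  rwa [one_div, mul_comm] at h

theorem gradient_comp_of_hasDerivAt {E : Type*} [NormedAddCommGroup E] [InnerProductSpace ℝ E]
    [CompleteSpace E] {d : E → ℝ} {g x : E} {h : ℝ → ℝ} {h' : ℝ} (hh : HasDerivAt h h' (d x))
    (hd : HasGradientAt d g x) : gradient (fun y => h (d y)) x = h' • g := by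
  refine HasGradientAt.gradient ?_
  have hcomp := hh.comp_hasFDerivAt x hd.hasFDerivAt
  rwa [← map_smul, ← hasGradientAt_iff_hasFDerivAt] at hcomp

section RampDepth

variable {L : Plane ≃ₗᵢ[ℝ] Plane} {f : ℝ → ℝ} {ψ : Plane → ℝ} {δ : ℝ}

theorem contDiff_ramp_depth (hf : ContDiff ℝ ∞ f) (δ : ℝ) :
    ContDiff ℝ ∞ fun x => ramp (depth L f x / δ) :=
  contDiff_ramp.comp ((contDiff_depth hf).div_const δ)

theorem gradient_mul_ramp_depth (hf : ContDiff ℝ ∞ f) {x : Plane} (hψ : DifferentiableAt ℝ ψ x) :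
    gradient (fun x => ψ x * ramp (depth L f x / δ)) x =
      ramp (depth L f x / δ) • gradient ψ x -
        (δ⁻¹ * deriv ramp (depth L f x / δ)) • ψ x • graphNormal L f ((L x) 0) := by
  rw [gradient_mul hψ ((contDiff_ramp_depth hf δ).differentiable (by simp) x),
    gradient_comp_of_hasDerivAt (hasDerivAt_ramp_div _ δ)
      (hasGradientAt_depth (hf.differentiable (by simp)) x)]
  module

theorem tsupport_mul_ramp_depth_subset (hf : Continuous f) (hδ : 0 < δ) :
    tsupport (fun x => ψ x * ramp (depth L f x / δ)) ⊆ tsupport ψ ∩ {x | 0 < depth L f x} := by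
  have hsub : tsupport (fun x => ψ x * ramp (depth L f x / δ)) ⊆
      tsupport ψ ∩ {x | δ ≤ depth L f x} := by
    refine closure_minimal (fun x hx => ?_) ((isClosed_tsupport ψ).inter
      (isClosed_le continuous_const (contDiff_depth (contDiff_zero.2 hf)).continuous))
    refine ⟨subset_tsupport _ (left_ne_zero_of_mul hx), ?_⟩
    by_contra hlt
    exact right_ne_zero_of_mul hx (ramp_of_le_one ((div_le_one hδ).2 (not_le.1 hlt).le))
  exact hsub.trans (inter_subset_inter_right _ fun x hx => hδ.trans_le hx)

end RampDepth

/-- Green's formula `∫_Ω φ ∇ψ = -∫_Ω ψ H + ∫_∂Ω φ ψ ν dσ` for a function `φ` with gradient `H`. -/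
def GreenIdentity (Ω : Set Plane) (φ : Plane → ℝ) (H : Plane → Plane) (ψ : Plane → ℝ) : Prop :=
  ∫ x in Ω, φ x • gradient ψ x =
    - (∫ x in Ω, ψ x • H x) + ∫ y, (φ y * ψ y) • outwardNormal Ω y ∂(boundaryMeasure Ω)

/-- Green's formula for the smooth test functions compactly supported in `W`. -/
def GreenIdentityOn (Ω : Set Plane) (φ : Plane → ℝ) (H : Plane → Plane) (W : Set Plane) : Prop :=
  ∀ ψ : Plane → ℝ, ContDiff ℝ ∞ ψ → HasCompactSupport ψ → tsupport ψ ⊆ W → GreenIdentity Ω φ H ψ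

namespace IsGraphChart

variable {Ω : Set Plane} {p : Plane} {L : Plane ≃ₗᵢ[ℝ] Plane} {f : ℝ → ℝ} {r : ℝ}

theorem mono (h : IsGraphChart Ω p L f r) {r' : ℝ} (hr' : 0 < r') (hle : r' ≤ r) :
    IsGraphChart Ω p L f r' :=
  ⟨h.contDiff, hr', fun x hx => h.mem_iff x (Metric.ball_subset_ball hle hx)⟩

theorem tendsto_setIntegral_ramp_smul (h : IsGraphChart Ω p L f r) (hΩ : IsOpen Ω) {F : Type*}
    [NormedAddCommGroup F] [NormedSpace ℝ F] {k : Plane → F} (hk : IntegrableOn k Ω)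
    (hk0 : ∀ x ∉ Metric.ball p r, k x = 0) :
    Tendsto (fun δ : ℝ => ∫ x in Ω, ramp (depth L f x / δ) • k x) (𝓝[>] 0)
      (𝓝 (∫ x in Ω, k x)) := by
  refine tendsto_integral_filter_of_dominated_convergence (fun x => ‖k x‖)
    (Eventually.of_forall fun δ =>
      (contDiff_ramp_depth h.contDiff δ).continuous.aestronglyMeasurable.smul hk.1)
    (Eventually.of_forall fun δ => Eventually.of_forall fun x => ?_) hk.norm
    ((ae_restrict_iff' hΩ.measurableSet).2 (Eventually.of_forall fun x hx => ?_))
  · rw [norm_smul]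
    exact mul_le_of_le_one_left (norm_nonneg _) (norm_ramp_le_one _)
  · by_cases hxp : x ∈ Metric.ball p r
    · simpa only [one_smul] using (tendsto_ramp_div ((h.mem_iff x hxp).1 hx)).smul_const (k x)
    · simp only [hk0 x hxp, smul_zero, tendsto_const_nhds]

variable {φ ψ : Plane → ℝ} {H : Plane → Plane}

theorem setIntegral_ramp_smul_gradient (h : IsGraphChart Ω p L f r)
    (hw : HasWeakGradient Ω φ H) (hφi : IntegrableOn φ Ω) (hψ : ContDiff ℝ ∞ ψ)
    (hc : HasCompactSupport ψ) (hs : tsupport ψ ⊆ Metric.ball p r) {δ : ℝ} (hδ : 0 < δ) :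
    ∫ x in Ω, ramp (depth L f x / δ) • φ x • gradient ψ x =
      - (∫ x in Ω, ramp (depth L f x / δ) • ψ x • H x) +
        ∫ x in Ω, (δ⁻¹ * deriv ramp (depth L f x / δ)) •
          (φ x * ψ x) • graphNormal L f ((L x) 0) := by
  have hsupp : tsupport (fun x => ψ x * ramp (depth L f x / δ)) ⊆ Ω := fun x hx =>
    have hx' := tsupport_mul_ramp_depth_subset h.contDiff.continuous hδ hx
    (h.mem_iff x (hs hx'.1)).2 hx'.2
  have hweak := hw.integral_eq _ (hψ.mul (contDiff_ramp_depth h.contDiff δ)) hc.mul_right hsupp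
  have hN : Continuous fun x : Plane => graphNormal L f ((L x) 0) :=
    (continuous_graphNormal h.contDiff_one).comp (contDiff_coord (n := 0) 0).continuous
  have hρ : Continuous fun x => δ⁻¹ * deriv ramp (depth L f x / δ) := continuous_const.mul
    (continuous_deriv_ramp.comp ((contDiff_depth (n := 1) h.contDiff_one).continuous.div_const δ))
  have hφl := hφi.locallyIntegrable.locallyIntegrableOn univ
  have hint_grad : IntegrableOn (fun x => φ x • ramp (depth L f x / δ) • gradient ψ x) Ω :=
    integrable_smul_of_tsupport_subset hφl ((contDiff_ramp_depth h.contDiff δ).continuous.smul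
      (continuous_gradient (hψ.of_le (by simp))))
      (HasCompactSupport.smul_left (f := fun x => ramp (depth L f x / δ))
        (hasCompactSupport_gradient hc)) (subset_univ _)
  have hint_normal : IntegrableOn (fun x => φ x • (δ⁻¹ * deriv ramp (depth L f x / δ)) • ψ x •
      graphNormal L f ((L x) 0)) Ω :=
    integrable_smul_of_tsupport_subset hφl (hρ.smul (hψ.continuous.smul hN))
      (HasCompactSupport.smul_left (f := fun x => δ⁻¹ * deriv ramp (depth L f x / δ))
        hc.smul_right) (subset_univ _)
  simp only [gradient_mul_ramp_depth h.contDiff (hψ.differentiable (by simp) _), smul_sub]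
    at hweak
  rw [integral_sub hint_grad hint_normal, sub_eq_iff_eq_add] at hweak
  simpa only [smul_comm (φ _), mul_comm (ψ _), mul_smul] using hweak

theorem greenIdentityOn (h : IsGraphChart Ω p L f r) (hΩ : IsOpen Ω)
    (hw : HasWeakGradient Ω φ H) (hφi : IntegrableOn φ Ω) (hHi : IntegrableOn H Ω)
    (hφ : ContinuousOn φ (Metric.ball p r ∩ closure Ω)) :
    GreenIdentityOn Ω φ H (Metric.ball p r) := by
  intro ψ hψ hc hs
  have hψ0 : ∀ x ∉ Metric.ball p r, ψ x = 0 := fun x hx =>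
    image_eq_zero_of_notMem_tsupport fun hx' => hx (hs hx')
  have hN : Continuous fun x : Plane => graphNormal L f ((L x) 0) :=
    (continuous_graphNormal h.contDiff_one).comp (contDiff_coord (n := 0) 0).continuous
  have hgrad := h.tendsto_setIntegral_ramp_smul hΩ (k := fun x => φ x • gradient ψ x)
    (integrable_smul_of_tsupport_subset (hφi.locallyIntegrable.locallyIntegrableOn univ)
      (continuous_gradient (hψ.of_le (by simp))) (hasCompactSupport_gradient hc) (subset_univ _))
    fun x hx => by rw [image_eq_zero_of_notMem_tsupport fun hx' =>
      hx (hs (tsupport_gradient_subset ψ hx')), smul_zero]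
  have hweak := h.tendsto_setIntegral_ramp_smul hΩ (k := fun x => ψ x • H x)
    (integrable_smul_of_tsupport_subset' (hHi.locallyIntegrable.locallyIntegrableOn univ)
      hψ.continuous hc (subset_univ _)) fun x hx => by rw [hψ0 x hx, zero_smul]
  have htsupp : tsupport (fun x => (φ x * ψ x) • graphNormal L f ((L x) 0)) ⊆ tsupport ψ :=
    (tsupport_smul_subset_left _ _).trans (tsupport_mul_subset_right)
  have hslab := h.tendsto_integral_slab hΩ
    (k := fun x => (φ x * ψ x) • graphNormal L f ((L x) 0))
    ((hφ.mul hψ.continuous.continuousOn).smul hN.continuousOn) hc.mul_left.smul_right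
    (htsupp.trans hs) continuous_deriv_ramp hasCompactSupport_deriv_ramp
    (tsupport_deriv_ramp_subset.trans fun t ht => zero_lt_one.trans_le ht.1)
  have hbdry : ∫ y, (φ y * ψ y) • outwardNormal Ω y ∂(boundaryMeasure Ω) =
      ∫ s, (φ (graphPt L f s) * ψ (graphPt L f s)) •
        graphNormal L f ((L (graphPt L f s)) 0) := by
    rw [h.setIntegral_boundaryMeasure hΩ fun x hx => by rw [hψ0 x hx, mul_zero, zero_smul]]
    refine integral_congr_ae (Eventually.of_forall fun s => ?_)
    by_cases hb : graphPt L f s ∈ Metric.ball p r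
    · simp only [h.outwardNormal_eq hb (depth_graphPt s), apply_graphPt_zero,
        smul_comm _ ‖graphNormal L f s‖⁻¹, inv_smul_smul₀ (norm_graphNormal_pos s).ne']
    · simp only [hψ0 _ hb, mul_zero, zero_smul, smul_zero]
  rw [integral_deriv_ramp, one_smul, ← hbdry] at hslab
  refine tendsto_nhds_unique (hgrad.congr' ?_) (hweak.neg.add hslab)
  filter_upwards [self_mem_nhdsWithin] with δ hδ
  exact h.setIntegral_ramp_smul_gradient hw hφi hψ hc hs hδ

end IsGraphChart

section GreenIdentity

variable {Ω : Set Plane} {φ ψ ψ₁ ψ₂ : Plane → ℝ} {H : Plane → Plane} {W W₁ W₂ : Set Plane}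

theorem HasWeakGradient.greenIdentityOn (hw : HasWeakGradient Ω φ H) (hΩ : IsOpen Ω) :
    GreenIdentityOn Ω φ H Ω := by
  intro ψ hψ hc hs
  have hbdry : ∫ y, (φ y * ψ y) • outwardNormal Ω y ∂(boundaryMeasure Ω) = 0 :=
    setIntegral_eq_zero_of_forall_eq_zero fun y hy => by
      rw [image_eq_zero_of_notMem_tsupport fun h => notMem_of_mem_frontier hΩ hy (hs h), mul_zero,
        zero_smul]
  rw [GreenIdentity, hw.integral_eq ψ hψ hc hs, hbdry, add_zero]

theorem greenIdentityOn_empty : GreenIdentityOn Ω φ H ∅ := by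
  intro ψ _ _ hs
  have hψ : ψ = fun _ => 0 := tsupport_eq_empty_iff.1 (subset_empty_iff.1 hs)
  simp only [GreenIdentity, hψ, gradient_fun_const, smul_zero, zero_smul, mul_zero, integral_zero,
    neg_zero, add_zero]

theorem GreenIdentity.congr (hΩ : IsOpen Ω) (h : GreenIdentity Ω φ H ψ₁)
    (heq : ψ₁ =ᶠ[𝓝ˢ (closure Ω)] ψ₂) : GreenIdentity Ω φ H ψ₂ := by
  have hev : ∀ x ∈ closure Ω, ψ₁ =ᶠ[𝓝 x] ψ₂ := fun x hx => heq.filter_mono (nhds_le_nhdsSet hx)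
  have hgrad : EqOn (fun x => φ x • gradient ψ₁ x) (fun x => φ x • gradient ψ₂ x) Ω :=
    fun x hx => by simp only [(hev x (subset_closure hx)).gradient_eq]
  have hsmul : EqOn (fun x => ψ₁ x • H x) (fun x => ψ₂ x • H x) Ω :=
    fun x hx => by simp only [(hev x (subset_closure hx)).eq_of_nhds]
  have hbdry : EqOn (fun y => (φ y * ψ₁ y) • outwardNormal Ω y)
      (fun y => (φ y * ψ₂ y) • outwardNormal Ω y) (frontier Ω) :=
    fun y hy => by simp only [(hev y (frontier_subset_closure hy)).eq_of_nhds]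
  rwa [GreenIdentity, setIntegral_congr_fun hΩ.measurableSet hgrad,
    setIntegral_congr_fun hΩ.measurableSet hsmul, boundaryMeasure,
    setIntegral_congr_fun isClosed_frontier.measurableSet hbdry] at h

theorem GreenIdentity.add (hb : Bornology.IsBounded Ω) [IsFiniteMeasure (boundaryMeasure Ω)]
    (hν : ContinuousOn (outwardNormal Ω) (frontier Ω)) (hφi : IntegrableOn φ Ω)
    (hHi : IntegrableOn H Ω) (hφ : ContinuousOn φ (frontier Ω))
    (hψ₁ : ContDiff ℝ 1 ψ₁) (hc₁ : HasCompactSupport ψ₁) (hψ₂ : ContDiff ℝ 1 ψ₂)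
    (hc₂ : HasCompactSupport ψ₂) (h₁ : GreenIdentity Ω φ H ψ₁) (h₂ : GreenIdentity Ω φ H ψ₂) :
    GreenIdentity Ω φ H fun x => ψ₁ x + ψ₂ x := by
  have hint_grad {ψ : Plane → ℝ} (hψ : ContDiff ℝ 1 ψ) (hc : HasCompactSupport ψ) :
      IntegrableOn (fun x => φ x • gradient ψ x) Ω :=
    integrable_smul_of_tsupport_subset (hφi.locallyIntegrable.locallyIntegrableOn univ)
      (continuous_gradient hψ) (hasCompactSupport_gradient hc) (subset_univ _)
  have hint_smul {ψ : Plane → ℝ} (hψ : ContDiff ℝ 1 ψ) (hc : HasCompactSupport ψ) :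
      IntegrableOn (fun x => ψ x • H x) Ω :=
    integrable_smul_of_tsupport_subset' (hHi.locallyIntegrable.locallyIntegrableOn univ)
      hψ.continuous hc (subset_univ _)
  have hint_bdry {ψ : Plane → ℝ} (hψ : ContDiff ℝ 1 ψ) :
      Integrable (fun y => (φ y * ψ y) • outwardNormal Ω y) (boundaryMeasure Ω) :=
    memLp_one_iff_integrable.1 (memLp_boundaryMeasure_of_continuousOn hb
      ((hφ.mul hψ.continuous.continuousOn).smul hν) 1)
  have hgrad : ∀ x, gradient (fun x => ψ₁ x + ψ₂ x) x = gradient ψ₁ x + gradient ψ₂ x := fun x => by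
    simp only [gradient, fderiv_fun_add
      (hψ₁.differentiable (by simp) x) (hψ₂.differentiable (by simp) x), map_add]
  rw [GreenIdentity] at *
  simp only [hgrad, smul_add, mul_add, add_smul]
  rw [integral_add (hint_grad hψ₁ hc₁) (hint_grad hψ₂ hc₂),
    integral_add (hint_smul hψ₁ hc₁) (hint_smul hψ₂ hc₂),
    integral_add (hint_bdry hψ₁) (hint_bdry hψ₂), h₁, h₂]
  abel

theorem GreenIdentityOn.union (hb : Bornology.IsBounded Ω) [IsFiniteMeasure (boundaryMeasure Ω)]
    (hν : ContinuousOn (outwardNormal Ω) (frontier Ω)) (hφi : IntegrableOn φ Ω)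
    (hHi : IntegrableOn H Ω) (hφ : ContinuousOn φ (frontier Ω)) (hW₁ : IsOpen W₁) (hW₂ : IsOpen W₂)
    (h₁ : GreenIdentityOn Ω φ H W₁) (h₂ : GreenIdentityOn Ω φ H W₂) :
    GreenIdentityOn Ω φ H (W₁ ∪ W₂) := by
  intro ψ hψ hc hs
  obtain ⟨χ, hχ, hχc, hχs, hχ_one⟩ := exists_cutoff (hc.isCompact.diff hW₂) hW₁ fun x hx =>
    (hs hx.1).resolve_right hx.2
  have hχψ : ContDiff ℝ ∞ fun x => χ x * ψ x := hχ.mul hψ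
  have hχψ' : ContDiff ℝ ∞ fun x => (1 - χ x) * ψ x := (contDiff_const.sub hχ).mul hψ
  have hsupp : tsupport (fun x => (1 - χ x) * ψ x) ⊆ W₂ := fun x hx => by
    by_contra hxW
    have hev := hχ_one.filter_mono (nhds_le_nhdsSet
      (show x ∈ tsupport ψ \ W₂ from ⟨tsupport_mul_subset_right hx, hxW⟩))
    refine notMem_tsupport_iff_eventuallyEq.2 ?_ hx
    filter_upwards [hev] with y hy
    rw [hy, sub_self, zero_mul, Pi.zero_apply]
  have hadd := GreenIdentity.add hb hν hφi hHi hφ (hχψ.of_le (by simp)) hχc.mul_right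
    (hχψ'.of_le (by simp)) hc.mul_left
    (h₁ _ hχψ hχc.mul_right (tsupport_mul_subset_left.trans hχs)) (h₂ _ hχψ' hc.mul_left hsupp)
  simpa only [← add_mul, add_sub_cancel, one_mul] using hadd

end GreenIdentity

namespace HasSmoothBoundary

variable {Ω U : Set Plane} {φ ψ : Plane → ℝ} {H : Plane → Plane}

theorem exists_greenIdentityOn (hs : HasSmoothBoundary Ω) (hΩ : IsOpen Ω) (hU : IsOpen U)
    (hfU : frontier Ω ⊆ U) (hw : HasWeakGradient Ω φ H) (hφi : IntegrableOn φ Ω)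
    (hHi : IntegrableOn H Ω) (hφ : ContinuousOn φ (U ∩ closure Ω)) {p : Plane}
    (hp : p ∈ closure Ω) : ∃ W, IsOpen W ∧ p ∈ W ∧ GreenIdentityOn Ω φ H W := by
  by_cases hpΩ : p ∈ Ω
  · exact ⟨Ω, hΩ, hpΩ, hw.greenIdentityOn hΩ⟩
  · have hpf : p ∈ frontier Ω := ⟨hp, by rwa [hΩ.interior_eq]⟩
    obtain ⟨L, f, r, h⟩ := hs.exists_isGraphChart hpf
    obtain ⟨r', hr', hr'U⟩ := Metric.isOpen_iff.1 hU p (hfU hpf)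
    have h' := h.mono (lt_min h.pos hr') (min_le_left _ _)
    exact ⟨_, Metric.isOpen_ball, Metric.mem_ball_self h'.pos, h'.greenIdentityOn hΩ hw hφi hHi
      (hφ.mono (inter_subset_inter_left _
        ((Metric.ball_subset_ball (min_le_right _ _)).trans hr'U)))⟩

theorem greenIdentity (hs : HasSmoothBoundary Ω) (hΩ : IsOpen Ω) (hb : Bornology.IsBounded Ω)
    (hU : IsOpen U) (hfU : frontier Ω ⊆ U) (hw : HasWeakGradient Ω φ H) (hφi : IntegrableOn φ Ω)
    (hHi : IntegrableOn H Ω) (hφ : ContinuousOn φ (U ∩ closure Ω)) (hψ : ContDiff ℝ ∞ ψ) :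
    GreenIdentity Ω φ H ψ := by
  have := hs.isFiniteMeasure_boundaryMeasure hΩ hb
  have hφf : ContinuousOn φ (frontier Ω) :=
    hφ.mono fun x hx => ⟨hfU hx, frontier_subset_closure hx⟩
  obtain ⟨W, hWo, hW, hgreen⟩ : ∃ W, IsOpen W ∧ closure Ω ⊆ W ∧ GreenIdentityOn Ω φ H W := by
    refine hb.isCompact_closure.induction_on
      (p := fun S => ∃ W, IsOpen W ∧ S ⊆ W ∧ GreenIdentityOn Ω φ H W)
      ⟨∅, isOpen_empty, subset_rfl, greenIdentityOn_empty⟩ ?_ ?_ ?_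
    · rintro S T hST ⟨W, hWo, hTW, hW⟩
      exact ⟨W, hWo, hST.trans hTW, hW⟩
    · rintro S T ⟨W₁, ho₁, hS, h₁⟩ ⟨W₂, ho₂, hT, h₂⟩
      exact ⟨W₁ ∪ W₂, ho₁.union ho₂, union_subset_union hS hT,
        h₁.union hb (hs.continuousOn_outwardNormal hΩ) hφi hHi hφf ho₁ ho₂ h₂⟩
    · intro p hp
      obtain ⟨W, hWo, hpW, hW⟩ := hs.exists_greenIdentityOn hΩ hU hfU hw hφi hHi hφ hp
      exact ⟨W, mem_nhdsWithin_of_mem_nhds (hWo.mem_nhds hpW), W, hWo, subset_rfl, hW⟩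
  obtain ⟨χ, hχ, hχc, hχs, hχ_one⟩ := exists_cutoff hb.isCompact_closure hWo hW
  refine (hgreen (fun x => χ x * ψ x) (hχ.mul hψ) hχc.mul_right
    (tsupport_mul_subset_left.trans hχs)).congr hΩ ?_
  filter_upwards [hχ_one] with x hx
  rw [hx, one_mul]

end HasSmoothBoundary

/-! ### The divergence theorem -/

/-- The divergence of a planar vector field. -/
def divergence (X : Plane → Plane) (x : Plane) : ℝ := ∑ i, gradient (fun y => X y i) x i

theorem integrableOn_smul_of_continuous {X F : Type*} [PseudoMetricSpace X] [ProperSpace X]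
    [MeasurableSpace X] [OpensMeasurableSpace X] [NormedAddCommGroup F] [NormedSpace ℝ F]
    [SecondCountableTopologyEither X F] {μ : Measure X} {s : Set X} (hb : Bornology.IsBounded s)
    {f : X → ℝ} {v : X → F} (hf : IntegrableOn f s μ) (hv : Continuous v) :
    IntegrableOn (fun x => f x • v x) s μ := by
  obtain ⟨C, hC⟩ := hb.isCompact_closure.exists_bound_of_continuousOn hv.continuousOn
  exact hf.smul_bdd C hv.aestronglyMeasurable (ae_restrict_of_ae_restrict_of_subset subset_closure
    (ae_restrict_of_forall_mem isClosed_closure.measurableSet hC))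

theorem integrableOn_continuous_smul {X F : Type*} [PseudoMetricSpace X] [ProperSpace X]
    [MeasurableSpace X] [OpensMeasurableSpace X] [NormedAddCommGroup F] [NormedSpace ℝ F]
    {μ : Measure X} {s : Set X} (hb : Bornology.IsBounded s)
    {f : X → F} {v : X → ℝ} (hf : IntegrableOn f s μ) (hv : Continuous v) :
    IntegrableOn (fun x => v x • f x) s μ := by
  obtain ⟨C, hC⟩ := hb.isCompact_closure.exists_bound_of_continuousOn hv.continuousOn
  exact hf.bdd_smul C hv.aestronglyMeasurable (ae_restrict_of_ae_restrict_of_subset subset_closure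
    (ae_restrict_of_forall_mem isClosed_closure.measurableSet hC))

theorem integral_plane_apply {α : Type*} [MeasurableSpace α] {μ : Measure α} {F : α → Plane}
    (hF : Integrable F μ) (i : Fin 2) : (∫ a, F a ∂μ) i = ∫ a, F a i ∂μ :=
  ((EuclideanSpace.proj (𝕜 := ℝ) i).integral_comp_comm hF).symm

theorem integrable_plane_apply {α : Type*} [MeasurableSpace α] {μ : Measure α} {F : α → Plane}
    (hF : Integrable F μ) (i : Fin 2) : Integrable (fun a => F a i) μ :=
  (EuclideanSpace.proj (𝕜 := ℝ) i).integrable_comp hF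

namespace HasSmoothBoundary

variable {Ω U : Set Plane} {φ : Plane → ℝ} {H : Plane → Plane} {P : Plane}

theorem integral_mul_divergence (hs : HasSmoothBoundary Ω) (hΩ : IsOpen Ω)
    (hb : Bornology.IsBounded Ω) (hU : IsOpen U) (hfU : frontier Ω ⊆ U)
    (hw : HasWeakGradient Ω φ H) (hφi : IntegrableOn φ Ω) (hHi : IntegrableOn H Ω)
    (hφ : ContinuousOn φ (U ∩ closure Ω)) {X : Plane → Plane} (hX : ContDiff ℝ ∞ X) :
    ∫ x in Ω, φ x * divergence X x = - (∫ x in Ω, ⟪X x, H x⟫) +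
      ∫ y, φ y * ⟪X y, outwardNormal Ω y⟫ ∂(boundaryMeasure Ω) := by
  have := hs.isFiniteMeasure_boundaryMeasure hΩ hb
  have hXi : ∀ i, ContDiff ℝ ∞ fun y => X y i := contDiff_euclidean.1 hX
  have hgrad := fun i => integrableOn_smul_of_continuous hb hφi
    (continuous_gradient ((hXi i).of_le (by simp)))
  have hinner := fun i => integrableOn_continuous_smul hb hHi (hXi i).continuous
  have hbdry : ∀ i, Integrable (fun y => (φ y * X y i) • outwardNormal Ω y) (boundaryMeasure Ω) :=
    fun i => memLp_one_iff_integrable.1 (memLp_boundaryMeasure_of_continuousOn hb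
      (((hφ.mono fun x hx => ⟨hfU hx, frontier_subset_closure hx⟩).mul
        (hXi i).continuous.continuousOn).smul (hs.continuousOn_outwardNormal hΩ)) 1)
  have hcoord : ∀ i, ∫ x in Ω, (φ x • gradient (fun y => X y i) x) i =
      - (∫ x in Ω, (X x i • H x) i) +
        ∫ y, ((φ y * X y i) • outwardNormal Ω y) i ∂(boundaryMeasure Ω) := fun i => by
    rw [← integral_plane_apply (hgrad i), ← integral_plane_apply (hinner i),
      ← integral_plane_apply (hbdry i),
      show _ = _ from hs.greenIdentity hΩ hb hU hfU hw hφi hHi hφ (hXi i)]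
    rfl
  calc ∫ x in Ω, φ x * divergence X x
      = ∑ i, ∫ x in Ω, (φ x • gradient (fun y => X y i) x) i := by
        rw [← integral_finsetSum _ fun i _ => integrable_plane_apply (hgrad i) i]
        simp only [divergence, Finset.mul_sum, PiLp.smul_apply, smul_eq_mul]
    _ = - (∑ i, ∫ x in Ω, (X x i • H x) i) +
        ∑ i, ∫ y, ((φ y * X y i) • outwardNormal Ω y) i ∂(boundaryMeasure Ω) := by
        simp only [hcoord, Finset.sum_add_distrib, Finset.sum_neg_distrib]
    _ = _ := by
        rw [← integral_finsetSum _ fun i _ => integrable_plane_apply (hinner i) i,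
          ← integral_finsetSum _ fun i _ => integrable_plane_apply (hbdry i) i]
        simp only [PiLp.inner_apply, PiLp.smul_apply, smul_eq_mul, Finset.mul_sum,
          RCLike.inner_apply, conj_trivial, mul_assoc, mul_comm]

end HasSmoothBoundary

/-! ### The regularised pole -/

/-- The kernel `(x - P) / |x - P|²`, regularised at scale `ε`; `ε = 0` gives the kernel itself,
with value `0` at the pole. -/
def poleField (P : Plane) (ε : ℝ) (x : Plane) : Plane := (‖x - P‖ ^ 2 + ε ^ 2)⁻¹ • (x - P)

/-- The divergence of `poleField P ε`, an approximation of `2π δ_P`. -/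
def poleDiv (P : Plane) (ε : ℝ) (x : Plane) : ℝ := 2 * ε ^ 2 / (‖x - P‖ ^ 2 + ε ^ 2) ^ 2

section Pole

variable {P : Plane} {ε : ℝ}

theorem contDiff_poleField (P : Plane) (hε : 0 < ε) : ContDiff ℝ ∞ (poleField P ε) :=
  ((((contDiff_id.sub contDiff_const).norm_sq ℝ).add contDiff_const).inv
    fun _ => by positivity).smul (contDiff_id.sub contDiff_const)

theorem continuous_poleDiv (P : Plane) (hε : 0 < ε) : Continuous (poleDiv P ε) :=
  continuous_const.div (by fun_prop) fun _ => by positivity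

theorem fderiv_poleField_apply (P x v : Plane) (hε : 0 < ε) (i : Fin 2) :
    fderiv ℝ (fun y => poleField P ε y i) x v = (‖x - P‖ ^ 2 + ε ^ 2)⁻¹ * v i -
      2 * ⟪x - P, v⟫ / (‖x - P‖ ^ 2 + ε ^ 2) ^ 2 * (x - P) i := by
  have hD : ‖x - P‖ ^ 2 + ε ^ 2 ≠ 0 := by positivity
  have hsub : HasFDerivAt (fun y : Plane => y - P) (ContinuousLinearMap.id ℝ Plane) x :=
    (hasFDerivAt_id x).sub_const P
  have hinv := (hasDerivAt_inv hD).comp_hasFDerivAt x (hsub.norm_sq.add_const (ε ^ 2))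
  have h : HasFDerivAt (fun y => poleField P ε y i) _ x :=
    (EuclideanSpace.proj (𝕜 := ℝ) i).hasFDerivAt.comp x (hinv.smul hsub)
  rw [h.fderiv, inner_sub_left]
  simp
  ring

theorem divergence_poleField (P : Plane) (hε : 0 < ε) :
    divergence (poleField P ε) = poleDiv P ε := by
  funext x
  have hcoord : ∀ i, gradient (fun y => poleField P ε y i) x i =
      (‖x - P‖ ^ 2 + ε ^ 2)⁻¹ - 2 * (x - P) i / (‖x - P‖ ^ 2 + ε ^ 2) ^ 2 * (x - P) i := fun i => by
    have h := fderiv_poleField_apply P x (EuclideanSpace.single i 1) hε i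
    rw [← inner_gradient_left, EuclideanSpace.inner_single_right,
      EuclideanSpace.inner_single_right] at h
    simpa only [PiLp.single_apply, if_true, one_mul, mul_one, conj_trivial] using h
  have hD : ‖x - P‖ ^ 2 + ε ^ 2 ≠ 0 := by positivity
  have hn : ‖x - P‖ ^ 2 = (x - P) 0 ^ 2 + (x - P) 1 ^ 2 := by
    rw [EuclideanSpace.norm_sq_eq, Fin.sum_univ_two, Real.norm_eq_abs, Real.norm_eq_abs, sq_abs,
      sq_abs]
  simp only [divergence, Fin.sum_univ_two, hcoord, poleDiv]
  field_simp
  rw [hn]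
  ring

theorem poleDiv_nonneg (P : Plane) (ε : ℝ) (x : Plane) : 0 ≤ poleDiv P ε x := by
  unfold poleDiv
  positivity

theorem sq_mul_poleDiv (P y : Plane) (hε : 0 < ε) :
    ε ^ 2 * poleDiv P ε (P + ε • y) = 2 / (‖y‖ ^ 2 + 1) ^ 2 := by
  rw [poleDiv, add_sub_cancel_left, norm_smul, Real.norm_of_nonneg hε.le]
  field_simp

theorem poleDiv_le {r : ℝ} (hr : 0 < r) (hε : ε ^ 2 ≤ 1) {x : Plane} (hx : r ≤ ‖x - P‖) :
    poleDiv P ε x ≤ 2 / (r ^ 2) ^ 2 := by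
  have hle : r ^ 2 ≤ ‖x - P‖ ^ 2 + ε ^ 2 := by
    linarith [pow_le_pow_left₀ hr.le hx 2, sq_nonneg ε]
  exact div_le_div₀ (by norm_num) (by linarith) (by positivity)
    (pow_le_pow_left₀ (by positivity) hle 2)

theorem tendsto_poleDiv {x : Plane} (hx : x ≠ P) :
    Tendsto (fun ε => poleDiv P ε x) (𝓝[>] 0) (𝓝 0) := by
  have hc : ContinuousAt (fun ε : ℝ => 2 * ε ^ 2 / (‖x - P‖ ^ 2 + ε ^ 2) ^ 2) 0 :=
    ContinuousAt.div (by fun_prop) (by fun_prop) (by simpa [sub_eq_zero] using hx)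
  simpa [poleDiv] using hc.tendsto.mono_left (nhdsWithin_le_nhds (s := Ioi 0))

theorem norm_poleField_le (P : Plane) (ε : ℝ) (x : Plane) : ‖poleField P ε x‖ ≤ ‖x - P‖⁻¹ := by
  rcases (norm_nonneg (x - P)).eq_or_lt with h | h
  · simp [poleField, norm_eq_zero.1 h.symm]
  rw [poleField, norm_smul, norm_inv, Real.norm_of_nonneg (by positivity)]
  calc (‖x - P‖ ^ 2 + ε ^ 2)⁻¹ * ‖x - P‖ ≤ (‖x - P‖ ^ 2)⁻¹ * ‖x - P‖ := by
        gcongr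
        linarith [sq_nonneg ε]
    _ = ‖x - P‖⁻¹ := by field_simp

theorem abs_inner_poleField_le {x v : Plane} {C : ℝ} (h : |⟪x - P, v⟫| ≤ C * ‖x - P‖ ^ 2) (ε : ℝ) :
    |⟪poleField P ε x, v⟫| ≤ max C 0 := by
  rcases (norm_nonneg (x - P)).eq_or_lt with h0 | h0
  · simp [poleField, norm_eq_zero.1 h0.symm]
  rw [poleField, real_inner_smul_left, abs_mul, abs_inv, abs_of_pos (by positivity),
    inv_mul_le_iff₀ (by positivity), mul_comm]
  refine h.trans (mul_le_mul (le_max_left _ _) ?_ (by positivity) (le_max_right _ _))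
  linarith [sq_nonneg ε]

theorem tendsto_poleField (P x : Plane) :
    Tendsto (fun ε => poleField P ε x) (𝓝[>] 0) (𝓝 (poleField P 0 x)) := by
  by_cases hx : x - P = 0
  · simp [poleField, hx]
  have hden : ContinuousAt (fun ε : ℝ => ‖x - P‖ ^ 2 + ε ^ 2) 0 := by fun_prop
  have hc : ContinuousAt (fun ε => poleField P ε x) 0 :=
    (hden.inv₀ (by simpa using hx)).smul continuousAt_const
  exact hc.tendsto.mono_left nhdsWithin_le_nhds

theorem measurable_poleField (P : Plane) (ε : ℝ) : Measurable (poleField P ε) := by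
  unfold poleField
  fun_prop

end Pole

/-! ### Radial integrals in the plane -/

theorem volume_real_unit_ball : (volume : Measure Plane).real (Metric.ball 0 1) = Real.pi := by
  simp [Measure.real, EuclideanSpace.volume_ball_fin_two, Real.pi_pos.le]

theorem hasDerivAt_neg_inv_sq_add_one (t : ℝ) :
    HasDerivAt (fun t : ℝ => -(t ^ 2 + 1)⁻¹) (t * (2 / (t ^ 2 + 1) ^ 2)) t := by
  have h0 : t ^ 2 + 1 ≠ 0 := by positivity
  have h1 : HasDerivAt (fun t : ℝ => t ^ 2 + 1) (2 * t) t := by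
    simpa using ((hasDerivAt_id t).pow 2).add_const (1 : ℝ)
  refine (h1.fun_inv h0).neg.congr_deriv ?_
  field_simp

theorem tendsto_neg_inv_sq_add_one : Tendsto (fun t : ℝ => -(t ^ 2 + 1)⁻¹) atTop (𝓝 0) := by
  simpa using (tendsto_atTop_add_const_right _ (1 : ℝ)
    (tendsto_pow_atTop (α := ℝ) two_ne_zero)).inv_tendsto_atTop.neg

theorem integrable_inv_norm_sq_add_one_sq : Integrable fun y : Plane => 2 / (‖y‖ ^ 2 + 1) ^ 2 := by
  rw [integrable_fun_norm_addHaar volume (f := fun r : ℝ => 2 / (r ^ 2 + 1) ^ 2)]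
  simp only [finrank_euclideanSpace, Fintype.card_fin, smul_eq_mul, Nat.add_one_sub_one, pow_one]
  exact integrableOn_Ioi_deriv_of_nonneg' (fun y _ => hasDerivAt_neg_inv_sq_add_one y)
    (fun y hy => mul_nonneg (le_of_lt hy) (by positivity)) tendsto_neg_inv_sq_add_one

theorem integral_inv_norm_sq_add_one_sq :
    ∫ y : Plane, 2 / (‖y‖ ^ 2 + 1) ^ 2 = 2 * Real.pi := by
  rw [integral_fun_norm_addHaar volume (fun r : ℝ => 2 / (r ^ 2 + 1) ^ 2), volume_real_unit_ball]
  have h := integral_Ioi_of_hasDerivAt_of_nonneg'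
    (fun y (_ : y ∈ Ici (0 : ℝ)) => hasDerivAt_neg_inv_sq_add_one y)
    (fun y hy => mul_nonneg (le_of_lt hy) (by positivity)) tendsto_neg_inv_sq_add_one
  simp only [finrank_euclideanSpace, Fintype.card_fin, smul_eq_mul, Nat.add_one_sub_one, pow_one, h]
  norm_num

theorem integrableOn_ball_inv_norm_sub (P : Plane) (r : ℝ) :
    IntegrableOn (fun x : Plane => ‖x - P‖⁻¹) (Metric.ball P r) := by
  have h : Integrable fun x : Plane => (Iio r).indicator (fun t : ℝ => t⁻¹) ‖x‖ := by
    rw [integrable_fun_norm_addHaar volume]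
    simp only [finrank_euclideanSpace, Fintype.card_fin, smul_eq_mul, Nat.add_one_sub_one, pow_one]
    have h1 : IntegrableOn (fun _ : ℝ => (1 : ℝ)) (Ioo 0 r) := integrableOn_const (by simp)
    refine ((integrable_indicator_iff measurableSet_Ioo).2 h1).integrableOn.congr_fun
      (fun t (ht : 0 < t) => ?_) measurableSet_Ioi
    by_cases htr : t < r <;> simp [indicator, htr, ht, ht.ne']
  rw [← integrable_indicator_iff Metric.isOpen_ball.measurableSet]
  refine (h.comp_sub_right P).congr (Eventually.of_forall fun x => ?_)
  simp [indicator, dist_eq_norm]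

theorem measurableSet_inner_neg {E : Type*} [NormedAddCommGroup E] [InnerProductSpace ℝ E]
    [MeasurableSpace E] [OpensMeasurableSpace E] (n : E) : MeasurableSet {y : E | ⟪y, n⟫ < 0} :=
  (isOpen_lt (continuous_id.inner continuous_const) continuous_const).measurableSet

section HalfSpace

variable {E : Type*} [NormedAddCommGroup E] [InnerProductSpace ℝ E] [FiniteDimensional ℝ E]
  [MeasurableSpace E] [BorelSpace E] {n : E}

theorem ae_inner_ne_zero (μ : Measure E) [μ.IsAddHaarMeasure] (hn : n ≠ 0) :
    ∀ᵐ y ∂μ, ⟪y, n⟫ ≠ 0 := by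
  have h := Measure.addHaar_submodule μ (ℝ ∙ n)ᗮ fun htop => hn (by
    have : n ∈ (ℝ ∙ n)ᗮ := htop ▸ Submodule.mem_top
    exact inner_self_eq_zero.1 (Submodule.mem_orthogonal_singleton_iff_inner_right.1 this))
  rw [ae_iff]
  convert h using 2
  ext y
  simp [Submodule.mem_orthogonal_singleton_iff_inner_left]

theorem two_mul_setIntegral_halfSpace (μ : Measure E) [μ.IsAddHaarMeasure] (hn : n ≠ 0)
    {k : E → ℝ} (hk : Integrable k μ) (hev : ∀ y, k (-y) = k y) :
    2 * ∫ y in {y : E | ⟪y, n⟫ < 0}, k y ∂μ = ∫ y, k y ∂μ := by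
  have hi := hk.indicator (measurableSet_inner_neg n)
  rw [← integral_indicator (measurableSet_inner_neg n), two_mul]
  nth_rewrite 2 [← integral_neg_eq_self]
  rw [← integral_add hi hi.comp_neg]
  refine integral_congr_ae ?_
  filter_upwards [ae_inner_ne_zero μ hn] with y hy
  rcases lt_or_gt_of_ne hy with h | h
  · simp [indicator, h, not_lt.2 h.le]
  · simp [indicator, h, not_lt.2 h.le, hev]

end HalfSpace

theorem integral_eq_integral_comp_add_smul (P : Plane) {ε : ℝ} (hε : 0 < ε) (F : Plane → ℝ) :
    ∫ x, F x = ∫ y, ε ^ 2 * F (P + ε • y) := by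
  rw [integral_const_mul, Measure.integral_comp_smul volume (fun y => F (P + y)) ε,
    integral_add_left_eq_self]
  simp only [finrank_euclideanSpace, Fintype.card_fin, smul_eq_mul]
  rw [abs_of_pos (by positivity), mul_inv_cancel_left₀ (by positivity)]

/-! ### Concentration of the regularised pole at a boundary point -/

section Concentration

variable {Ω : Set Plane} {P n : Plane}

theorem IsOutwardUnitNormal.tendsto_blowUp (hn : IsOutwardUnitNormal Ω P n) {κ : Plane → ℝ} {a : ℝ}
    (hκ : Tendsto κ (𝓝[Ω] P) (𝓝 a)) (hκΩ : ∀ x ∉ Ω, κ x = 0) {y : Plane} (hy : ⟪y, n⟫ ≠ 0) :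
    Tendsto (fun ε : ℝ => κ (P + ε • y)) (𝓝[>] 0)
      (𝓝 ({y : Plane | ⟪y, n⟫ < 0}.indicator (fun _ => a) y)) := by
  rcases lt_or_gt_of_ne hy with h | h
  · rw [indicator_of_mem (show y ∈ {y : Plane | ⟪y, n⟫ < 0} from h)]
    have hc : Continuous fun ε : ℝ => P + ε • y := by fun_prop
    have hpath : Tendsto (fun ε : ℝ => P + ε • y) (𝓝[>] 0) (𝓝 P) := by
      simpa using (hc.tendsto 0).mono_left (nhdsWithin_le_nhds (s := Ioi 0))
    exact hκ.comp (tendsto_nhdsWithin_iff.2 ⟨hpath, hn.2.1 y h⟩)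
  · rw [indicator_of_notMem (show y ∉ {y : Plane | ⟪y, n⟫ < 0} from not_lt.2 h.le)]
    refine tendsto_const_nhds.congr' ?_
    filter_upwards [hn.2.2 y h] with ε hε
    exact (hκΩ _ fun h' => hε (subset_closure h')).symm

-- Rescaling by `ε` around `P` turns `Ω` into a half-plane, which carries half of the total mass
-- `2π` of `poleDiv P ε`.
theorem IsOutwardUnitNormal.tendsto_integral_mul_poleDiv (hn : IsOutwardUnitNormal Ω P n)
    {κ : Plane → ℝ} {a C : ℝ} (hκm : Measurable κ) (hκC : ∀ x, ‖κ x‖ ≤ C)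
    (hκ : Tendsto κ (𝓝[Ω] P) (𝓝 a)) (hκΩ : ∀ x ∉ Ω, κ x = 0) :
    Tendsto (fun ε : ℝ => ∫ x, κ x * poleDiv P ε x) (𝓝[>] 0) (𝓝 (Real.pi * a)) := by
  have hn0 : n ≠ 0 := fun h => by simpa [h] using hn.1
  have hlim : Tendsto (fun ε : ℝ => ∫ y, κ (P + ε • y) * (2 / (‖y‖ ^ 2 + 1) ^ 2)) (𝓝[>] 0)
      (𝓝 (∫ y, {y : Plane | ⟪y, n⟫ < 0}.indicator (fun _ => a) y * (2 / (‖y‖ ^ 2 + 1) ^ 2))) := by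
    refine tendsto_integral_filter_of_dominated_convergence
      (fun y => C * (2 / (‖y‖ ^ 2 + 1) ^ 2)) (Eventually.of_forall fun ε => ?_)
      (Eventually.of_forall fun ε => Eventually.of_forall fun y => ?_)
      (integrable_inv_norm_sq_add_one_sq.const_mul _) ?_
    · have hc : Continuous fun y : Plane => P + ε • y := by fun_prop
      exact (hκm.comp hc.measurable).aestronglyMeasurable.mul integrable_inv_norm_sq_add_one_sq.1
    · rw [norm_mul, Real.norm_of_nonneg (by positivity : 0 ≤ 2 / (‖y‖ ^ 2 + 1) ^ 2)]
      exact mul_le_mul_of_nonneg_right (hκC _) (by positivity)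
    · filter_upwards [ae_inner_ne_zero volume hn0] with y hy
      exact (hn.tendsto_blowUp hκ hκΩ hy).mul_const _
  have hval : ∫ y, {y : Plane | ⟪y, n⟫ < 0}.indicator (fun _ => a) y * (2 / (‖y‖ ^ 2 + 1) ^ 2) =
      Real.pi * a := by
    have hhalf := two_mul_setIntegral_halfSpace volume hn0 integrable_inv_norm_sq_add_one_sq
      (fun y => by rw [norm_neg])
    rw [integral_inv_norm_sq_add_one_sq] at hhalf
    have hind : ∀ y, {y : Plane | ⟪y, n⟫ < 0}.indicator (fun _ => a) y * (2 / (‖y‖ ^ 2 + 1) ^ 2) =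
        {y : Plane | ⟪y, n⟫ < 0}.indicator (fun y => a * (2 / (‖y‖ ^ 2 + 1) ^ 2)) y := fun y =>
      (indicator_mul_left _ (fun _ => a) fun y => 2 / (‖y‖ ^ 2 + 1) ^ 2).symm
    simp only [hind]
    rw [integral_indicator (measurableSet_inner_neg n), integral_const_mul]
    linear_combination (a / 2) * hhalf
  rw [hval] at hlim
  refine hlim.congr' ?_
  filter_upwards [self_mem_nhdsWithin] with ε hε
  rw [integral_eq_integral_comp_add_smul P hε fun x => κ x * poleDiv P ε x]
  simp only [mul_left_comm (ε ^ 2), sq_mul_poleDiv P _ hε]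

theorem tendsto_setIntegral_mul_poleDiv_of_le {s : Set Plane} (hs : MeasurableSet s) {r : ℝ}
    (hr : 0 < r) (hsr : ∀ x ∈ s, r ≤ ‖x - P‖) {φ : Plane → ℝ} (hφ : IntegrableOn φ s) :
    Tendsto (fun ε : ℝ => ∫ x in s, φ x * poleDiv P ε x) (𝓝[>] 0) (𝓝 0) := by
  have hsr' : ∀ᵐ x ∂volume.restrict s, r ≤ ‖x - P‖ := ae_restrict_of_forall_mem hs hsr
  suffices h : Tendsto (fun ε : ℝ => ∫ x in s, φ x * poleDiv P ε x) (𝓝[>] 0)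
      (𝓝 (∫ _ in s, (0 : ℝ))) by simpa using h
  refine tendsto_integral_filter_of_dominated_convergence (fun x => ‖φ x‖ * (2 / (r ^ 2) ^ 2)) ?_ ?_
    (hφ.norm.mul_const _) ?_
  · filter_upwards [self_mem_nhdsWithin] with ε hε
    exact hφ.1.mul (continuous_poleDiv P hε).aestronglyMeasurable
  · filter_upwards [Ioo_mem_nhdsGT (zero_lt_one' ℝ)] with ε hε
    filter_upwards [hsr'] with x hx
    rw [norm_mul, Real.norm_of_nonneg (poleDiv_nonneg P ε x)]
    exact mul_le_mul_of_nonneg_left (poleDiv_le hr (pow_le_one₀ hε.1.le hε.2.le) hx) (norm_nonneg _)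
  · filter_upwards [hsr'] with x hx
    simpa using (tendsto_poleDiv (sub_ne_zero.1 (norm_pos_iff.1 (hr.trans_le hx)))).const_mul (φ x)

theorem IsOutwardUnitNormal.tendsto_setIntegral_inter_mul_poleDiv
    (hn : IsOutwardUnitNormal Ω P n) (hΩ : IsOpen Ω) {B : Set Plane} (hB : IsOpen B) (hPB : P ∈ B)
    {φ : Plane → ℝ} (hφ : ContinuousOn φ (B ∩ Ω)) (hφP : ContinuousWithinAt φ (B ∩ Ω) P) {C : ℝ}
    (hC : ∀ x ∈ B ∩ Ω, ‖φ x‖ ≤ C) :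
    Tendsto (fun ε : ℝ => ∫ x in B ∩ Ω, φ x * poleDiv P ε x) (𝓝[>] 0) (𝓝 (Real.pi * φ P)) := by
  classical
  have hBΩ : MeasurableSet (B ∩ Ω) := (hB.inter hΩ).measurableSet
  simp only [← integral_indicator hBΩ, indicator_mul_left]
  refine hn.tendsto_integral_mul_poleDiv (C := max C 0) ?_ (fun x => ?_) ?_
    fun x hx => indicator_of_notMem (fun h => hx h.2) _
  · rw [← piecewise_eq_indicator]
    exact hφ.measurable_piecewise continuousOn_const hBΩ
  · by_cases hx : x ∈ B ∩ Ω
    · rw [indicator_of_mem hx]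
      exact (hC x hx).trans (le_max_left _ _)
    · rw [indicator_of_notMem hx, norm_zero]
      exact le_max_right _ _
  · rw [← nhdsWithin_inter_of_mem (mem_nhdsWithin_of_mem_nhds (hB.mem_nhds hPB))]
    refine hφP.tendsto.congr' ?_
    filter_upwards [self_mem_nhdsWithin] with x hx
    rw [indicator_of_mem hx]

theorem IsOutwardUnitNormal.tendsto_setIntegral_mul_poleDiv (hn : IsOutwardUnitNormal Ω P n)
    (hΩ : IsOpen Ω) (hb : Bornology.IsBounded Ω) (hP : P ∈ closure Ω) {U : Set Plane}
    (hU : IsOpen U) (hPU : P ∈ U) {φ : Plane → ℝ} (hφi : IntegrableOn φ Ω)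
    (hφ : ContinuousOn φ (U ∩ closure Ω)) :
    Tendsto (fun ε : ℝ => ∫ x in Ω, φ x * poleDiv P ε x) (𝓝[>] 0) (𝓝 (Real.pi * φ P)) := by
  have hcP : ContinuousWithinAt φ (U ∩ closure Ω) P := hφ P ⟨hPU, hP⟩
  obtain ⟨r, hr, hr_le⟩ := Metric.mem_nhdsWithin_iff.1
    (hcP.norm.tendsto.eventually_le_const (lt_add_one ‖φ P‖))
  obtain ⟨ρ, hρ, hρU⟩ := Metric.isOpen_iff.1 hU P hPU
  set B := Metric.ball P (min r ρ)
  have hB : IsOpen B := Metric.isOpen_ball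
  have hBU : B ∩ Ω ⊆ U ∩ closure Ω := fun x hx =>
    ⟨hρU (Metric.ball_subset_ball (min_le_right _ _) hx.1), subset_closure hx.2⟩
  have hnear := hn.tendsto_setIntegral_inter_mul_poleDiv hΩ hB
    (Metric.mem_ball_self (lt_min hr hρ)) (hφ.mono hBU) (hcP.mono hBU)
    fun x hx => hr_le ⟨Metric.ball_subset_ball (min_le_left _ _) hx.1, hBU hx⟩
  have hfar := tendsto_setIntegral_mul_poleDiv_of_le (P := P) (hΩ.measurableSet.diff
    hB.measurableSet) (lt_min hr hρ) (fun x hx => by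
      simpa only [B, Metric.mem_ball, not_lt, dist_eq_norm] using hx.2) (hφi.mono_set sdiff_subset)
  refine (add_zero (Real.pi * φ P) ▸ hnear.add hfar).congr' ?_
  filter_upwards [self_mem_nhdsWithin] with ε hε
  rw [inter_comm]
  exact integral_inter_add_sdiff hB.measurableSet
    (integrableOn_smul_of_continuous hb hφi (continuous_poleDiv P hε))

end Concentration

/-! ### Green's formula with a pole on the boundary -/

theorem integrableOn_inv_norm_sub_mul {Ω : Set Plane} {H : Plane → Plane}
    (hHi : IntegrableOn H Ω) {P : Plane} {C r : ℝ} (hr : 0 < r)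
    (hC : ∀ᵐ x ∂volume.restrict (Ω ∩ Metric.ball P r), ‖H x‖ ≤ C) :
    IntegrableOn (fun x => ‖x - P‖⁻¹ * ‖H x‖) Ω := by
  have hm : Measurable fun x : Plane => ‖x - P‖⁻¹ := by fun_prop
  rw [← inter_union_sdiff Ω (Metric.ball P r)]
  refine IntegrableOn.union ?_ ?_
  · refine (((integrableOn_ball_inv_norm_sub P r).mono_set inter_subset_right).mul_const C).mono'
      (hm.aestronglyMeasurable.mul (hHi.mono_set inter_subset_left).1.norm) ?_
    filter_upwards [hC] with x hx
    rw [Real.norm_of_nonneg (by positivity)]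
    exact mul_le_mul_of_nonneg_left hx (by positivity)
  · refine ((hHi.mono_set sdiff_subset).norm.const_mul r⁻¹).mono'
      (hm.aestronglyMeasurable.mul (hHi.mono_set sdiff_subset).1.norm) ?_
    have hae : ∀ᵐ x ∂volume.restrict (Ω \ Metric.ball P r), x ∈ (Metric.ball P r)ᶜ :=
      ae_restrict_of_ae_restrict_of_subset (fun x hx => hx.2)
        (ae_restrict_mem Metric.isOpen_ball.measurableSet.compl)
    filter_upwards [hae] with x hx
    rw [mem_compl_iff, Metric.mem_ball, not_lt, dist_eq_norm] at hx
    rw [Real.norm_of_nonneg (by positivity)]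
    gcongr

theorem norm_inner_poleField_le (P : Plane) (ε : ℝ) (x v : Plane) :
    ‖⟪poleField P ε x, v⟫‖ ≤ ‖x - P‖⁻¹ * ‖v‖ :=
  (norm_inner_le_norm _ _).trans
    (mul_le_mul_of_nonneg_right (norm_poleField_le P ε x) (norm_nonneg _))

theorem integrableOn_inner_poleField {Ω : Set Plane} {H : Plane → Plane} {P : Plane}
    (hH : AEStronglyMeasurable H (volume.restrict Ω))
    (hi : IntegrableOn (fun x => ‖x - P‖⁻¹ * ‖H x‖) Ω) (ε : ℝ) :
    IntegrableOn (fun x => ⟪poleField P ε x, H x⟫) Ω :=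
  hi.mono' ((measurable_poleField P ε).aestronglyMeasurable.inner hH)
    (Eventually.of_forall fun x => norm_inner_poleField_le P ε x (H x))

theorem tendsto_setIntegral_inner_poleField {Ω : Set Plane} {H : Plane → Plane} {P : Plane}
    (hH : AEStronglyMeasurable H (volume.restrict Ω))
    (hi : IntegrableOn (fun x => ‖x - P‖⁻¹ * ‖H x‖) Ω) :
    Tendsto (fun ε : ℝ => ∫ x in Ω, ⟪poleField P ε x, H x⟫) (𝓝[>] 0)
      (𝓝 (∫ x in Ω, ⟪poleField P 0 x, H x⟫)) :=
  tendsto_integral_filter_of_dominated_convergence _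
    (Eventually.of_forall fun ε => (integrableOn_inner_poleField hH hi ε).1)
    (Eventually.of_forall fun ε =>
      Eventually.of_forall fun x => norm_inner_poleField_le P ε x (H x))
    hi (Eventually.of_forall fun x => (tendsto_poleField P x).inner tendsto_const_nhds)

namespace HasSmoothBoundary

variable {Ω U : Set Plane} {φ : Plane → ℝ} {H : Plane → Plane} {P : Plane}

theorem exists_ae_norm_mul_inner_poleField_le (hs : HasSmoothBoundary Ω) (hΩ : IsOpen Ω)
    (hP : P ∈ frontier Ω) (φ : Plane → ℝ) : ∃ C, ∀ ε : ℝ, ∀ᵐ y ∂boundaryMeasure Ω,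
      ‖φ y * ⟪poleField P ε y, outwardNormal Ω y⟫‖ ≤ ‖φ y‖ * C := by
  obtain ⟨C, hC⟩ := hs.exists_abs_inner_outwardNormal_le hΩ hP
  refine ⟨max C 0, fun ε =>
    ae_restrict_of_forall_mem isClosed_frontier.measurableSet fun y hy => ?_⟩
  rw [norm_mul]
  exact mul_le_mul_of_nonneg_left (abs_inner_poleField_le (hC y hy) ε) (norm_nonneg _)

theorem aestronglyMeasurable_mul_inner_poleField (hs : HasSmoothBoundary Ω) (hΩ : IsOpen Ω)
    (hφ : ContinuousOn φ (frontier Ω)) (P : Plane) (ε : ℝ) :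
    AEStronglyMeasurable (fun y => φ y * ⟪poleField P ε y, outwardNormal Ω y⟫)
      (boundaryMeasure Ω) :=
  (hφ.aestronglyMeasurable isClosed_frontier.measurableSet).mul
    ((measurable_poleField P ε).aestronglyMeasurable.inner
      ((hs.continuousOn_outwardNormal hΩ).aestronglyMeasurable isClosed_frontier.measurableSet))

theorem integrable_boundaryMeasure (hs : HasSmoothBoundary Ω) (hΩ : IsOpen Ω)
    (hb : Bornology.IsBounded Ω) (hφ : ContinuousOn φ (frontier Ω)) :
    Integrable φ (boundaryMeasure Ω) :=
  have := hs.isFiniteMeasure_boundaryMeasure hΩ hb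
  memLp_one_iff_integrable.1 (memLp_boundaryMeasure_of_continuousOn hb hφ 1)

theorem integrable_mul_inner_poleField (hs : HasSmoothBoundary Ω) (hΩ : IsOpen Ω)
    (hb : Bornology.IsBounded Ω) (hP : P ∈ frontier Ω) (hφ : ContinuousOn φ (frontier Ω)) (ε : ℝ) :
    Integrable (fun y => φ y * ⟪poleField P ε y, outwardNormal Ω y⟫) (boundaryMeasure Ω) := by
  obtain ⟨C, hC⟩ := hs.exists_ae_norm_mul_inner_poleField_le hΩ hP φ
  exact ((hs.integrable_boundaryMeasure hΩ hb hφ).norm.mul_const C).mono'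
    (hs.aestronglyMeasurable_mul_inner_poleField hΩ hφ P ε) (hC ε)

theorem tendsto_integral_mul_inner_poleField (hs : HasSmoothBoundary Ω) (hΩ : IsOpen Ω)
    (hb : Bornology.IsBounded Ω) (hP : P ∈ frontier Ω) (hφ : ContinuousOn φ (frontier Ω)) :
    Tendsto (fun ε : ℝ => ∫ y, φ y * ⟪poleField P ε y, outwardNormal Ω y⟫ ∂(boundaryMeasure Ω))
      (𝓝[>] 0) (𝓝 (∫ y, φ y * ⟪poleField P 0 y, outwardNormal Ω y⟫ ∂(boundaryMeasure Ω))) := by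
  obtain ⟨C, hC⟩ := hs.exists_ae_norm_mul_inner_poleField_le hΩ hP φ
  exact tendsto_integral_filter_of_dominated_convergence _
    (Eventually.of_forall (hs.aestronglyMeasurable_mul_inner_poleField hΩ hφ P))
    (Eventually.of_forall hC) ((hs.integrable_boundaryMeasure hΩ hb hφ).norm.mul_const C)
    (Eventually.of_forall fun y => ((tendsto_poleField P y).inner tendsto_const_nhds).const_mul _)

theorem integral_inner_poleField (hs : HasSmoothBoundary Ω) (hΩ : IsOpen Ω)
    (hb : Bornology.IsBounded Ω) (hU : IsOpen U) (hfU : frontier Ω ⊆ U)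
    (hw : HasWeakGradient Ω φ H) (hφi : IntegrableOn φ Ω) (hHi : IntegrableOn H Ω)
    (hφ : ContinuousOn φ (U ∩ closure Ω)) (hP : P ∈ frontier Ω)
    (hi : IntegrableOn (fun x => ‖x - P‖⁻¹ * ‖H x‖) Ω) :
    ∫ x in Ω, ⟪poleField P 0 x, H x⟫ =
      (∫ y, φ y * ⟪poleField P 0 y, outwardNormal Ω y⟫ ∂(boundaryMeasure Ω)) - Real.pi * φ P := by
  have hφf : ContinuousOn φ (frontier Ω) :=
    hφ.mono fun x hx => ⟨hfU hx, frontier_subset_closure hx⟩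
  have hdiv := (hs.isOutwardUnitNormal hΩ hP).tendsto_setIntegral_mul_poleDiv hΩ hb
    (frontier_subset_closure hP) hU (hfU hP) hφi hφ
  have hgreen := (tendsto_setIntegral_inner_poleField hHi.1 hi).neg.add
    (hs.tendsto_integral_mul_inner_poleField hΩ hb hP hφf)
  have heq := tendsto_nhds_unique hdiv (hgreen.congr' (by
    filter_upwards [self_mem_nhdsWithin] with ε hε
    rw [← divergence_poleField P hε, hs.integral_mul_divergence hΩ hb hU hfU hw hφi hHi hφ
      (contDiff_poleField P hε)]))
  linarith

end HasSmoothBoundary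

theorem exists_eventually_norm_gradient_le {E : Type*} [NormedAddCommGroup E]
    [InnerProductSpace ℝ E] [CompleteSpace E] {f : E → ℝ} {s : Set E} {x : E}
    (hf : ContDiffWithinAt ℝ 1 f s x) (hx : x ∈ s) :
    ∃ C, ∀ᶠ y in 𝓝[s] x, s ∈ 𝓝 y → ‖gradient f y‖ ≤ C := by
  obtain ⟨u, hu, -, f', hf', hc⟩ :=
    (contDiffWithinAt_succ_iff_hasFDerivWithinAt (n := 0) (by simp)).1 (by simpa using hf)
  rw [insert_eq_of_mem hx] at hu
  obtain ⟨O, hO, hxO, hOu⟩ := mem_nhdsWithin.1 hu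
  have hle := hc.continuousWithinAt.norm.tendsto.eventually_le_const (lt_add_one ‖f' x‖)
  refine ⟨‖f' x‖ + 1, ?_⟩
  filter_upwards [nhdsWithin_le_of_mem hu hle, self_mem_nhdsWithin,
    mem_nhdsWithin_of_mem_nhds (hO.mem_nhds hxO)] with y hy hys hyO hsy
  have hd : HasFDerivAt f (f' y) y := (hf' y (hOu ⟨hyO, hys⟩)).hasFDerivAt
    (mem_of_superset (inter_mem (hO.mem_nhds hyO) hsy) hOu)
  rwa [gradient, LinearIsometryEquiv.norm_map, hd.fderiv]

theorem HasWeakGradient.exists_ae_norm_le {Ω U : Set Plane} (hΩ : IsOpen Ω) (hU : IsOpen U)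
    {φ : Plane → ℝ} {H : Plane → Plane} (hw : HasWeakGradient Ω φ H)
    (hφ : ContDiffOn ℝ 1 φ (U ∩ closure Ω)) {P : Plane} (hPU : P ∈ U) (hP : P ∈ closure Ω) :
    ∃ C r : ℝ, 0 < r ∧ ∀ᵐ x ∂volume.restrict (Ω ∩ Metric.ball P r), ‖H x‖ ≤ C := by
  obtain ⟨C, hC⟩ := exists_eventually_norm_gradient_le (hφ P ⟨hPU, hP⟩) ⟨hPU, hP⟩
  obtain ⟨r, hr, hr_le⟩ := Metric.mem_nhdsWithin_iff.1 hC
  obtain ⟨ρ, hρ, hρU⟩ := Metric.isOpen_iff.1 hU P hPU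
  have hW : IsOpen (Ω ∩ Metric.ball P (min r ρ)) := hΩ.inter Metric.isOpen_ball
  have hWU : Ω ∩ Metric.ball P (min r ρ) ⊆ U ∩ closure Ω := fun x hx =>
    ⟨hρU (Metric.ball_subset_ball (min_le_right _ _) hx.2), subset_closure hx.1⟩
  refine ⟨C, min r ρ, lt_min hr hρ, ?_⟩
  filter_upwards [(hw.mono inter_subset_left).ae_eq hW (.of_contDiffOn hW (hφ.mono hWU)),
    ae_restrict_mem hW.measurableSet] with x hx hxW
  rw [hx]
  exact hr_le ⟨Metric.ball_subset_ball (min_le_left _ _) hxW.2, hWU hxW⟩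
    (mem_of_superset (hW.mem_nhds hxW) hWU)

/-! ### The singular potential -/

section Potential

variable {P Q x : Plane}

theorem hasGradientAt_log_norm_sub (h : x ≠ P) :
    HasGradientAt (fun y : Plane => Real.log ‖P - y‖) (poleField P 0 x) x := by
  have hne : ‖x - P‖ ^ 2 ≠ 0 := pow_ne_zero 2 (norm_ne_zero_iff.2 (sub_ne_zero.2 h))
  have hsub : HasFDerivAt (fun y : Plane => y - P) (ContinuousLinearMap.id ℝ Plane) x :=
    (hasFDerivAt_id x).sub_const P
  have hlog : (fun y : Plane => Real.log ‖P - y‖) = fun y => 1 / 2 * Real.log (‖y - P‖ ^ 2) := by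
    funext y
    rw [Real.log_pow, norm_sub_rev, Nat.cast_ofNat, ← mul_assoc, one_div_mul_cancel two_ne_zero,
      one_mul]
  rw [hasGradientAt_iff_hasFDerivAt, hlog]
  refine ((hsub.norm_sq.log hne).const_mul (1 / 2 : ℝ)).congr_fderiv
    (ContinuousLinearMap.ext fun v => ?_)
  rw [InnerProductSpace.toDual_apply_apply, poleField, real_inner_smul_left, inner_sub_left]
  simp only [one_div, map_sub, ContinuousLinearMap.comp_id, smul_apply, sub_apply,
    coe_innerSL_apply, nsmul_eq_mul, Nat.cast_ofNat, smul_eq_mul, ne_eq, OfNat.ofNat_ne_zero,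
    not_false_eq_true, zero_pow, add_zero]
  ring

theorem gradient_V (hP : x ≠ P) (hQ : x ≠ Q) :
    gradient (V P Q) x = -(1 / Real.pi) • (poleField P 0 x - poleField Q 0 x) := by
  have h : HasGradientAt (V P Q) (-(1 / Real.pi) • (poleField P 0 x - poleField Q 0 x)) x := by
    rw [hasGradientAt_iff_hasFDerivAt, map_smul, map_sub]
    exact ((hasGradientAt_log_norm_sub hP).hasFDerivAt.sub
      (hasGradientAt_log_norm_sub hQ).hasFDerivAt).const_mul (-(1 / Real.pi))
  exact h.gradient

theorem contDiffAt_log_norm_sub (h : x ≠ P) :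
    ContDiffAt ℝ ∞ (fun y : Plane => Real.log ‖P - y‖) x :=
  ((contDiffAt_const.sub contDiffAt_id).norm ℝ (sub_ne_zero.2 h.symm)).log
    (norm_ne_zero_iff.2 (sub_ne_zero.2 h.symm))

theorem contDiffAt_V (hP : x ≠ P) (hQ : x ≠ Q) : ContDiffAt ℝ ∞ (V P Q) x :=
  contDiffAt_const.mul ((contDiffAt_log_norm_sub hP).sub (contDiffAt_log_norm_sub hQ))

theorem hasWeakGradient_V {Ω : Set Plane} (hΩ : IsOpen Ω) (hP : P ∉ Ω) (hQ : Q ∉ Ω) :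
    HasWeakGradient Ω (V P Q) (gradient (V P Q)) :=
  .of_contDiffOn hΩ fun _ hx => ((contDiffAt_V (ne_of_mem_of_not_mem hx hP)
    (ne_of_mem_of_not_mem hx hQ)).of_le (by simp)).contDiffWithinAt

theorem Psi_eq (Ω : Set Plane) (P Q y : Plane) : Psi Ω P Q y =
    -(1 / Real.pi) * (⟪poleField P 0 y, outwardNormal Ω y⟫ -
      ⟪poleField Q 0 y, outwardNormal Ω y⟫) := by
  simp only [Psi, poleField, inner_sub_left, one_div, ne_eq, OfNat.ofNat_ne_zero,
    not_false_eq_true, zero_pow, add_zero]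

theorem inner_gradient_V {Ω : Set Plane} (hP : P ∉ Ω) (hQ : Q ∉ Ω) (H : Plane → Plane) :
    EqOn (fun x => ⟪gradient (V P Q) x, H x⟫)
      (fun x => -(1 / Real.pi) * (⟪poleField P 0 x, H x⟫ - ⟪poleField Q 0 x, H x⟫)) Ω :=
  fun x hx => by
    simp only [gradient_V (ne_of_mem_of_not_mem hx hP) (ne_of_mem_of_not_mem hx hQ),
      real_inner_smul_left, inner_sub_left]

end Potential

theorem HasWeakGradient.integrableOn_inv_norm_sub_mul {Ω U : Set Plane} (hΩ : IsOpen Ω)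
    (hU : IsOpen U) {φ : Plane → ℝ} {H : Plane → Plane} (hw : HasWeakGradient Ω φ H)
    (hHi : IntegrableOn H Ω) (hφ : ContDiffOn ℝ 1 φ (U ∩ closure Ω)) {P : Plane} (hPU : P ∈ U)
    (hP : P ∈ closure Ω) : IntegrableOn (fun x => ‖x - P‖⁻¹ * ‖H x‖) Ω :=
  have ⟨_, _, hr, hC⟩ := hw.exists_ae_norm_le hΩ hU hφ hPU hP
  PointCurrent.integrableOn_inv_norm_sub_mul hHi hr hC

theorem integrableOn_inner_gradient_V {Ω : Set Plane} (hΩ : IsOpen Ω) {H : Plane → Plane}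
    (hH : AEStronglyMeasurable H (volume.restrict Ω)) {P Q : Plane} (hP : P ∉ Ω) (hQ : Q ∉ Ω)
    (hiP : IntegrableOn (fun x => ‖x - P‖⁻¹ * ‖H x‖) Ω)
    (hiQ : IntegrableOn (fun x => ‖x - Q‖⁻¹ * ‖H x‖) Ω) :
    IntegrableOn (fun x => ⟪gradient (V P Q) x, H x⟫) Ω :=
  IntegrableOn.congr_fun (((integrableOn_inner_poleField hH hiP 0).sub
    (integrableOn_inner_poleField hH hiQ 0)).const_mul (-(1 / Real.pi)))
    (inner_gradient_V hP hQ H).symm hΩ.measurableSet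

theorem HasSmoothBoundary.integral_inner_gradient_V {Ω U : Set Plane} (hs : HasSmoothBoundary Ω)
    (hΩ : IsOpen Ω) (hb : Bornology.IsBounded Ω) (hU : IsOpen U) (hfU : frontier Ω ⊆ U)
    {φ : Plane → ℝ} {H : Plane → Plane} (hw : HasWeakGradient Ω φ H) (hφi : IntegrableOn φ Ω)
    (hHi : IntegrableOn H Ω) (hφ : ContinuousOn φ (U ∩ closure Ω)) {P Q : Plane}
    (hP : P ∈ frontier Ω) (hQ : Q ∈ frontier Ω)
    (hiP : IntegrableOn (fun x => ‖x - P‖⁻¹ * ‖H x‖) Ω)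
    (hiQ : IntegrableOn (fun x => ‖x - Q‖⁻¹ * ‖H x‖) Ω) :
    ∫ x in Ω, ⟪gradient (V P Q) x, H x⟫ =
      (∫ y, Psi Ω P Q y * φ y ∂(boundaryMeasure Ω)) + (φ P - φ Q) := by
  have hφf : ContinuousOn φ (frontier Ω) :=
    hφ.mono fun x hx => ⟨hfU hx, frontier_subset_closure hx⟩
  have hflux : ∫ y, Psi Ω P Q y * φ y ∂(boundaryMeasure Ω) = -(1 / Real.pi) *
      ((∫ y, φ y * ⟪poleField P 0 y, outwardNormal Ω y⟫ ∂(boundaryMeasure Ω)) -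
        ∫ y, φ y * ⟪poleField Q 0 y, outwardNormal Ω y⟫ ∂(boundaryMeasure Ω)) := by
    rw [← integral_sub (hs.integrable_mul_inner_poleField hΩ hb hP hφf 0)
      (hs.integrable_mul_inner_poleField hΩ hb hQ hφf 0), ← integral_const_mul]
    refine integral_congr_ae (Eventually.of_forall fun y => ?_)
    simp only [Psi_eq]
    ring
  rw [setIntegral_congr_fun hΩ.measurableSet (inner_gradient_V (notMem_of_mem_frontier hΩ hP)
      (notMem_of_mem_frontier hΩ hQ) H), integral_const_mul,
    integral_sub (integrableOn_inner_poleField hHi.1 hiP 0)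
      (integrableOn_inner_poleField hHi.1 hiQ 0),
    hs.integral_inner_poleField hΩ hb hU hfU hw hφi hHi hφ hP hiP,
    hs.integral_inner_poleField hΩ hb hU hfU hw hφi hHi hφ hQ hiQ, hflux]
  have := Real.pi_ne_zero
  field_simp
  ring

/-! ### The solution with point currents -/

theorem MemH1.hasH1Gradient {Ω : Set Plane} (hΩ : IsOpen Ω) {φ : Plane → ℝ} {H : Plane → Plane}
    (hφ : MemH1 Ω φ) (hH : HasWeakGradient Ω φ H) : HasH1Gradient Ω φ H :=
  have ⟨_, h⟩ := hφ
  ⟨h.memLp, (memLp_congr_ae (hH.ae_eq hΩ h.weak)).2 h.memLp_gradient, hH⟩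

theorem HasH1Gradient.integrableOn_inner {Ω : Set Plane} {u v : Plane → ℝ} {G H : Plane → Plane}
    (hu : HasH1Gradient Ω u G) (hv : HasH1Gradient Ω v H) :
    IntegrableOn (fun x => ⟪G x, H x⟫) Ω :=
  (hu.memLp_gradient.norm.integrable_mul hv.memLp_gradient.norm).mono'
    (hu.memLp_gradient.1.inner hv.memLp_gradient.1)
    (Eventually.of_forall fun _ => norm_inner_le_norm _ _)

theorem IsConductivity.eqOn_sum_indicator {Ω : Set Plane} {m : ℕ} {D : Fin m → Set Plane}
    (hD : IsInclusion Ω D) {γ : Plane → ℝ} (hγ : IsConductivity Ω D γ) :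
    ∃ k : Fin m → ℝ, EqOn γ (fun x => 1 + ∑ j, (D j).indicator (fun _ => k j - 1) x) Ω := by
  choose k _ hk using hγ.const_on_component
  refine ⟨k, fun x hx => ?_⟩
  by_cases hxD : x ∈ ⋃ j, D j
  · obtain ⟨j, hj⟩ := mem_iUnion.1 hxD
    have hother : ∀ i ∈ Finset.univ, i ≠ j → (D i).indicator (fun _ => k i - 1) x = 0 :=
      fun i _ hij => indicator_of_notMem (fun hi => disjoint_left.1 (hD.disjoint_closure i j hij)
        (subset_closure hi) (subset_closure hj)) _
    simp only [Finset.sum_eq_single j hother (by simp), indicator_of_mem hj, hk j x hj,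
      add_sub_cancel]
  · have hnone : ∀ i ∈ Finset.univ, (D i).indicator (fun _ => k i - 1) x = 0 :=
      fun i _ => indicator_of_notMem (fun hi => hxD (mem_iUnion.2 ⟨i, hi⟩)) _
    simp only [Finset.sum_eq_zero hnone, hγ.eq_one x ⟨hx, hxD⟩, add_zero]

theorem IsConductivity.exists_bound {Ω : Set Plane} (hΩ : IsOpen Ω) {m : ℕ}
    {D : Fin m → Set Plane} (hD : IsInclusion Ω D) {γ : Plane → ℝ} (hγ : IsConductivity Ω D γ) :
    AEStronglyMeasurable γ (volume.restrict Ω) ∧ ∃ M, ∀ x ∈ Ω, ‖γ x‖ ≤ M := by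
  obtain ⟨k, hk⟩ := hγ.eqOn_sum_indicator hD
  have hmeas : Measurable fun x => 1 + ∑ j, (D j).indicator (fun _ => k j - 1) x :=
    measurable_const.add (Finset.measurable_sum _ fun j _ =>
      measurable_const.indicator (hD.isOpen j).measurableSet)
  refine ⟨hmeas.aestronglyMeasurable.congr (ae_restrict_of_forall_mem hΩ.measurableSet hk.symm),
    1 + ∑ j, ‖k j - 1‖, fun x hx => ?_⟩
  rw [hk hx]
  exact (norm_add_le _ _).trans (add_le_add norm_one.le ((norm_sum_le _ _).trans
    (Finset.sum_le_sum fun j _ => norm_indicator_le_norm_self _ _)))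

end PointCurrent

end

open PointCurrent in
theorem proposition2p1_general {Ω : Set Plane} (hs : HasSmoothBoundary Ω) (hΩ : IsOpen Ω)
    (hb : Bornology.IsBounded Ω) {γ : Plane → ℝ}
    (hγ : AEStronglyMeasurable γ (volume.restrict Ω)) {M : ℝ} (hM : ∀ x ∈ Ω, ‖γ x‖ ≤ M)
    {P Q : Plane} (hP : P ∈ frontier Ω) (hQ : Q ∈ frontier Ω) {e : Plane → ℝ}
    (he : IsCorrector Ω γ P Q e) :
    (∃ G : Plane → Plane, HasWeakGradient Ω (fun x => V P Q x + e x) G) ∧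
    ∀ φ : Plane → ℝ, MemH1 Ω φ →
      (∃ U, IsOpen U ∧ frontier Ω ⊆ U ∧ ContDiffOn ℝ 1 φ (U ∩ closure Ω)) →
      ∀ G H : Plane → Plane,
        HasWeakGradient Ω (fun x => V P Q x + e x) G → HasWeakGradient Ω φ H →
        IntegrableOn (fun x => γ x * inner ℝ (G x) (H x)) Ω ∧
        ∫ x in Ω, γ x * inner ℝ (G x) (H x) = φ P - φ Q := by
  have hP' := notMem_of_mem_frontier hΩ hP
  have hQ' := notMem_of_mem_frontier hΩ hQ
  obtain ⟨E, hE⟩ := he.memH1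
  have hsum := (hasWeakGradient_V hΩ hP' hQ').add hE.weak
  refine ⟨⟨_, hsum⟩, fun φ hφ ⟨U, hU, hfU, hφU⟩ G H hG hH => ?_⟩
  have := hs.isFiniteMeasure_boundaryMeasure hΩ hb
  have : IsFiniteMeasure (volume.restrict Ω) := ⟨by simpa using hb.measure_lt_top⟩
  have hφH := hφ.hasH1Gradient hΩ hH
  have hHi : IntegrableOn H Ω := hφH.memLp_gradient.integrable one_le_two
  have hpole : ∀ R ∈ frontier Ω, IntegrableOn (fun x => ‖x - R‖⁻¹ * ‖H x‖) Ω := fun R hR =>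
    hH.integrableOn_inv_norm_sub_mul hΩ hU hHi hφU (hfU hR) (frontier_subset_closure hR)
  have hVi := integrableOn_inner_gradient_V hΩ hHi.1 hP' hQ' (hpole P hP) (hpole Q hQ)
  have hV := hs.integral_inner_gradient_V hΩ hb hU hfU hH (hφH.memLp.integrable one_le_two) hHi
    hφU.continuousOn hP hQ (hpole P hP) (hpole Q hQ)
  have hγi : ∀ {f : Plane → ℝ}, IntegrableOn f Ω → IntegrableOn (fun x => γ x * f x) Ω :=
    fun hf => hf.bdd_mul (c := M) hγ (ae_restrict_of_forall_mem hΩ.measurableSet hM)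
  have hγE := hγi (hE.integrableOn_inner hφH)
  have hae : (fun x => γ x * inner ℝ (G x) (H x)) =ᵐ[volume.restrict Ω] fun x =>
      γ x * inner ℝ (gradient (V P Q) x) (H x) + γ x * inner ℝ (E x) (H x) := by
    filter_upwards [hG.ae_eq hΩ hsum] with x hx
    rw [hx, Pi.add_apply, inner_add_left, mul_add]
  have hweak := he.weak_eq E φ H φ hE hφH (hasTrace_self hΩ hb hU hfU hφH hφU.continuousOn)
  refine ⟨((hγi hVi).add hγE).congr hae.symm, ?_⟩
  simp only [sub_mul, one_mul] at hweak
  rw [integral_sub (hγi hVi) hVi, hV] at hweak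
  rw [integral_congr_ae hae, integral_add (hγi hVi) hγE, hweak]
  ring

open PointCurrent in
theorem proposition2p1 (Ω : Set Plane) (hΩ : IsSmoothBoundedDomain Ω)
    (m : ℕ) (D : Fin m → Set Plane) (hD : IsInclusion Ω D)
    (γ : Plane → ℝ) (hγ : IsConductivity Ω D γ)
    (P Q : Plane) (hP : P ∈ frontier Ω) (hQ : Q ∈ frontier Ω) (hPQ : P ≠ Q)
    (e : Plane → ℝ) (he : IsCorrector Ω γ P Q e) :
    (∃ G : Plane → Plane, HasWeakGradient Ω (fun x => V P Q x + e x) G) ∧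
    ∀ φ : Plane → ℝ, MemH1 Ω φ → IsSmoothNearBoundary Ω φ →
      ∀ G H : Plane → Plane,
        HasWeakGradient Ω (fun x => V P Q x + e x) G → HasWeakGradient Ω φ H →
        IntegrableOn (fun x => γ x * inner ℝ (G x) (H x)) Ω ∧
        ∫ x in Ω, γ x * inner ℝ (G x) (H x) = φ P - φ Q := by
  obtain ⟨hγm, M, hM⟩ := hγ.exists_bound hΩ.isOpen hD
  have h := proposition2p1_general hΩ.smooth hΩ.isOpen hΩ.isBounded hγm hM hP hQ he
  exact ⟨h.1, fun φ hφ ⟨U, hU, hfU, hφU⟩ => h.2 φ hφ ⟨U, hU, hfU, hφU.of_le (by simp)⟩⟩
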